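/- Let $t$ be an indeterminate and let $\mathscr U(t)$ be the associative unital $\mathbb Q[t,t^{-1}]$-algebra generated by $u_i,u_{i^\vee}$ ($i\ge 1$) with the relations $$u_iu_ju_k=u_iu_ku_j,\quad u_{k^\vee}u_{j^\vee}u_{i^\vee}=u_{j^\vee}u_{k^\vee}u_{i^\vee}\quad (j\le i<k),$$ $$u_iu_ju_k=u_ju_iu_k,\quad u_{k^\vee}u_{j^\vee}u_{i^\vee}=u_{k^\vee}u_{i^\vee}u_{j^\vee}\quad (j<k\le i),$$ $$u_{i+1}u_{(i+1)^\vee}=u_{i^\vee}u_i\ (i\ge1),\qquad u_1u_{1^\vee}=t,\qquad u_iu_{j^\vee}=u_{j^\vee}u_i\ (i\ne j).$$ Let $\widehat{\mathscr U(t)}\supset\mathscr U(t)$ be the completed algebra of possibly infinite $\mathbb Q[t,t^{-1}]$-linear combinations of monomials of bounded length in the generators (two monomials that agree up to a power of $t$ being identified up to that power), with coefficientwise convergence. Let $\mathcal A,\mathcal B$ be at most countable linearly ordered $\mathbb Z_2$-graded sets, write $|a|$ for the degree of $a$, and let $x_a$ $(a\in\mathcal A)$, $x_b$ $(b\in\mathcal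 B)$ be formal variables commuting with each other and with all coefficients. For $a\in\mathcal A$, $b\in\mathcal B$ put $$\mathscr Q(x_a)=\begin{cases}\bigl((1-u_1x_a)(1-u_2x_a)\cdots\bigr)^{-1}&|a|=0,\\(1+u_1x_a)(1+u_2x_a)\cdots&|a|=1,\end{cases}\qquad \mathscr P(x_b)=\begin{cases}\bigl(\cdots(1-u_{2^\vee}x_b)(1-u_{1^\vee}x_b)\bigr)^{-1}&|b|=0,\\\cdots(1+u_{2^\vee}x_b)(1+u_{1^\vee}x_b)&|b|=1,\end{cases}$$ and $\mathscr Q(\mathbf x_{\mathcal A})=\overrightarrow{\prod}_{a\in\mathcal A}\mathscr Q(x_a)$, $\mathscr P(\mathbf x_{\mathcal B})=\overrightarrow{\prod}_{b\in\mathcal B}\mathscr P(x_b)$, with smaller indices to the left. (1) These infinite products converge to formal power series over $\widehat{\mathscr U(t)}$, and $$\mathscr Q(\mathbf x_{\mathcal A})\mathscr P(\mathbf x_{\mathcal B})=\mathscr P(\mathbf x_{\mathcal B})\mathscr Q(\mathbf x_{\mathcal A})\,\frac{\prod_{|a|\ne|b|}(1+t\,x_ax_b)}{\prod_{|a|=|b|}(1-t\,x_ax_b)}\qquad(a\in\mathcal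 A,\ b\in\mathcal B).$$ (2) Let $\Lambda(t)$ be the free $\mathbb Q[t,t^{-1}]$-module of symmetric functions, with basis the Schur functions $s_\mu$, and let $\overline u_{i^\vee}$ (resp. $\overline u_i$) be the Schur operator sending $s_\mu$ to $s_\nu$ (resp. $t\,s_\nu$), where $\nu$ is $\mu$ with a box added at the end of row $i$ (resp. with the last box of row $i$ removed), if this is possible and $\nu$ is a partition, and to $0$ otherwise. There is a $\mathbb Q[t,t^{-1}]$-algebra homomorphism $\psi:\mathscr U(t)\to\mathrm{End}(\Lambda(t))$ with $\psi(u_i)=\overline u_i$, $\psi(u_{i^\vee})=\overline u_{i^\vee}$, whose image is the subalgebra generated by the Schur operators. It extends to an algebra homomorphism $\widehat\psi$ on $\widehat{\mathscr U(t)}$. The products $\overline{\mathscr Q}(\mathbf x_{\mathcal A})$, $\overline{\mathscr P}(\mathbf x_{\mathcal B})$, obtained by replacing $u_i,u_{i^\vee}$ with $\overline u_i,\overline u_{i^\vee}$ in the above formulas, converge (for pointwise convergence of operators), are the images of $\mathscr Q(\mathbf x_{\mathcal A})$, $\mathscr P(\mathbf x_{\mathcal B})$ under $\widehat\psi$, and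 satisfy $$\overline{\mathscr Q}(\mathbf x_{\mathcal A})\overline{\mathscr P}(\mathbf x_{\mathcal B})=\overline{\mathscr P}(\mathbf x_{\mathcal B})\overline{\mathscr Q}(\mathbf x_{\mathcal A})\,\frac{\prod_{|a|\ne|b|}(1+t\,x_ax_b)}{\prod_{|a|=|b|}(1-t\,x_ax_b)}.$$ (3) The identity of (2) also holds over $\mathbb Q$ with $t=1$, for the Schur operators on $\bigoplus_\mu\mathbb Q s_\mu$ (with the products again convergent); for $\mathcal A=\mathcal B=\{1<2<\cdots\}$ with all degrees $0$ this is Fomin's generalized Cauchy identity $\mathscr Q(\mathbf y)\mathscr P(\mathbf x)=\mathscr P(\mathbf x)\mathscr Q(\mathbf y)\prod_{i,j}(1-x_iy_j)^{-1}$. -/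

import Mathlib

open scoped LaurentPolynomial MvPowerSeries.WithPiTopology

namespace PlacticCauchy

/-! Throughout, the index `i : ℕ` stands for the positive integer `i + 1`: the letters are
`u i` (for `u_{i+1}`) and `v i` (for `u_{(i+1)^∨}`), `i = 0, 1, 2, …`. -/

/-- The letters `i` (`pos`) and `i^∨` (`dual`). -/
inductive Letter : Type
  | pos (i : ℕ) : Letter
  | dual (i : ℕ) : Letter

/-- The defining relations of the plactic algebra on elements `u i`, `v i` of a monoid, with value
`c` of `u 0 * v 0`: the Knuth relations for the `u i` and (dually) for the `v i`, and the relations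
between the two families. -/
inductive PlacticRel {N : Type*} [Monoid N] (u v : ℕ → N) (c : N) : N → N → Prop
  | knuth₁ {i j k : ℕ} : j ≤ i → i < k → PlacticRel u v c (u i * u j * u k) (u i * u k * u j)
  | knuth₁_dual {i j k : ℕ} : j ≤ i → i < k →
      PlacticRel u v c (v k * v j * v i) (v j * v k * v i)
  | knuth₂ {i j k : ℕ} : j < k → k ≤ i → PlacticRel u v c (u i * u j * u k) (u j * u i * u k)
  | knuth₂_dual {i j k : ℕ} : j < k → k ≤ i →
      PlacticRel u v c (v k * v j * v i) (v k * v i * v j)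
  | shift (i : ℕ) : PlacticRel u v c (u (i + 1) * v (i + 1)) (v i * u i)
  | contract : PlacticRel u v c (u 0 * v 0) c
  | comm {i j : ℕ} : i ≠ j → PlacticRel u v c (u i * v j) (v j * u i)

/-- The plactic algebra: the associative unital `ℚ[t, t⁻¹]`-algebra presented by the generators
`u i`, `v i` and the plactic relations with `u 0 * v 0 = t`. -/
abbrev PlacticAlgebra : Type :=
  RingQuot (PlacticRel (N := FreeAlgebra ℚ[T;T⁻¹] Letter)
    (fun i => FreeAlgebra.ι ℚ[T;T⁻¹] (Letter.pos i))
    (fun i => FreeAlgebra.ι ℚ[T;T⁻¹] (Letter.dual i))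
    (algebraMap ℚ[T;T⁻¹] (FreeAlgebra ℚ[T;T⁻¹] Letter) (LaurentPolynomial.T 1)))

namespace PlacticAlgebra

/-- The generator `u_{i+1}` of the plactic algebra. -/
noncomputable def u (i : ℕ) : PlacticAlgebra :=
  RingQuot.mkAlgHom ℚ[T;T⁻¹] _ (FreeAlgebra.ι ℚ[T;T⁻¹] (Letter.pos i))

/-- The generator `u_{(i+1)^∨}` of the plactic algebra. -/
noncomputable def v (i : ℕ) : PlacticAlgebra :=
  RingQuot.mkAlgHom ℚ[T;T⁻¹] _ (FreeAlgebra.ι ℚ[T;T⁻¹] (Letter.dual i))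

end PlacticAlgebra

/-- The monoid presented by the plactic relations at `t = 1`. All plactic relations are homogeneous
when `u i`, `v i`, `t` are given the degrees `1`, `0`, `1`, so the plactic algebra is the
monoid algebra of `PlacticMonoid` over `ℚ[t, t⁻¹]`, with `u i = t • [u i]` and `v i = [v i]`;
see `PlacticAlgebra.toCompletion_injective` and `PlacticAlgebra.span_normalized`. -/
abbrev PlacticMonoid : Type :=
  PresentedMonoid (PlacticRel (N := FreeMonoid Letter)
    (fun i => .of (.pos i)) (fun i => .of (.dual i)) 1)

namespace PlacticMonoid

/-- The class of a word. -/
def mk : FreeMonoid Letter →* PlacticMonoid := PresentedMonoid.mk _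

/-- The class of the letter `u i`. -/
def u (i : ℕ) : PlacticMonoid := mk (.of (.pos i))
/-- The class of the letter `v i`. -/
def v (i : ℕ) : PlacticMonoid := mk (.of (.dual i))

/-- The elements represented by a word of length at most `n`. -/
def lengthLE (n : ℕ) : Set PlacticMonoid :=
  {m | ∃ w : FreeMonoid Letter, w.length ≤ n ∧ mk w = m}

/-- The index of a letter. -/
def _root_.PlacticCauchy.Letter.index : Letter → ℕ
  | .pos i => i
  | .dual i => i

/-! An element of the monoid is represented by only finitely many words of bounded length. This is
what makes the product of infinite sums of monomials of bounded length well defined. -/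

/-- Partial predecessor. -/
def down : Function.End (Option ℕ)
  | some (n + 1) => some n
  | _ => none

/-- Partial successor. -/
def up : Function.End (Option ℕ) := Option.map Nat.succ

theorem down_mul_up : down * up = 1 := by
  funext x
  cases x <;> rfl

/-- At place `p`, the letters `u p`, `v (p + 1)` remove a token and `u (p + 1)`, `v p` add one. -/
def tokenStep (p : ℕ) : Letter → Function.End (Option ℕ)
  | .pos i => if i = p then down else if i = p + 1 then up else 1
  | .dual i => if i = p then up else if i = p + 1 then down else 1

/-- The induced action of the plactic monoid at place `p`. -/
def token (p : ℕ) : PlacticMonoid →* Function.End (Option ℕ) :=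
  PresentedMonoid.lift (tokenStep p) <| by
    have h := down_mul_up

    intro a b hab
    cases hab <;> simp only [map_mul, map_one, FreeMonoid.lift_eval_of, tokenStep] <;>
      split_ifs <;> first | rfl | omega | (simp only [mul_assoc, h, mul_one, one_mul]) | contradiction


theorem token_eq_one (p : ℕ) (w : FreeMonoid Letter) (h : ∀ x ∈ w.toList, x.index < p ∨ p + 1 < x.index) :
    token p (mk w) = 1 := by
  induction w using FreeMonoid.inductionOn' with
  | one => simp
  | of_mul x w ih =>
    rw [map_mul, map_mul, ih fun y hy => h y (by simp [hy]), mul_one]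
    have hx := h x (by simp)
    change tokenStep p x = 1
    cases x <;> simp only [Letter.index] at hx <;> simp only [tokenStep] <;> split_ifs <;>
      first | rfl | omega

theorem index_le_of_token (L : ℕ) (w : FreeMonoid Letter)
    (h : ∀ p, L ≤ p → token p (mk w) (some 0) ≠ none) :
    ∀ x ∈ w.toList, x.index ≤ L + w.length := by
  induction w using FreeMonoid.inductionOn' with
  | one => simp
  | of_mul x w ih =>
    have hstep : ∀ p, token p (mk (FreeMonoid.of x * w)) (some 0) =
        tokenStep p x (token p (mk w) (some 0)) := fun p => by
      rw [map_mul, map_mul]; rfl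
    have hnone : ∀ p, tokenStep p x none = none := by
      intro p
      cases x <;> simp only [tokenStep] <;> split_ifs <;> rfl
    have ih' := ih fun p hp h0 => h p hp (by rw [hstep, h0, hnone])
    intro y hy
    simp only [FreeMonoid.toList_of_mul, List.mem_cons] at hy
    have hl : (FreeMonoid.of x * w).length = w.length + 1 := by
      simp [FreeMonoid.length_mul, add_comm]
    rw [hl]
    rcases hy with rfl | hy
    · by_contra hlt
      cases y with
      | pos i =>
        simp only [Letter.index] at hlt
        refine h i (by omega) ?_
        rw [hstep, token_eq_one i w fun z hz => .inl (by have := ih' z hz; omega)]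
        change tokenStep i (.pos i) (some 0) = none
        simp only [tokenStep, if_true]
        rfl
      | dual i =>
        simp only [Letter.index] at hlt
        obtain ⟨k, rfl⟩ : ∃ k, i = k + 1 := ⟨i - 1, by omega⟩
        refine h k (by omega) ?_
        rw [hstep, token_eq_one k w fun z hz => .inl (by have := ih' z hz; omega)]
        change tokenStep k (.dual (k + 1)) (some 0) = none
        simp only [tokenStep, if_true, Nat.succ_ne_self, if_false]
        rfl
    · have := ih' y hy
      omega

theorem exists_index_le (m : PlacticMonoid) :
    ∃ L, ∀ w : FreeMonoid Letter, mk w = m → ∀ x ∈ w.toList, x.index ≤ L + w.length := by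
  obtain ⟨w₀, hw₀⟩ : ∃ w₀, mk w₀ = m := PresentedMonoid.surjective_mk m
  refine ⟨(w₀.toList.map Letter.index).sum + 1, fun w hw => index_le_of_token _ w ?_⟩
  intro p hp
  rw [hw, ← hw₀, token_eq_one p w₀ fun x hx => .inl ?_]
  · exact fun h => nomatch h
  · have := List.single_le_sum (l := w₀.toList.map Letter.index) (by simp) x.index
      (List.mem_map_of_mem hx)
    omega

theorem words_finite (n B : ℕ) :
    {w : FreeMonoid Letter | w.length ≤ n ∧ ∀ x ∈ w.toList, x.index ≤ B}.Finite := by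
  have hfin : Finite {x : Letter // x.index ≤ B} := by
    refine Set.Finite.to_subtype (s := {x : Letter | x.index ≤ B}) ?_
    refine (((Set.finite_Iic B).image Letter.pos).union
      ((Set.finite_Iic B).image Letter.dual)).subset ?_
    rintro (i | i) hi
    · exact .inl ⟨i, hi, rfl⟩
    · exact .inr ⟨i, hi, rfl⟩
  refine ((List.finite_length_le {x : Letter // x.index ≤ B} n).image
    fun l => FreeMonoid.ofList (l.map Subtype.val)).subset ?_
  rintro w ⟨hw, hx⟩
  refine ⟨w.toList.attach.map fun x => ⟨x.1, hx x.1 x.2⟩, by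
    rw [Set.mem_ofPred_eq, List.length_map, List.length_attach]; exact hw, ?_⟩
  simp

/-- The elements represented by a factor of some word of length at most `n` representing `m`. -/
def factors (n : ℕ) (m : PlacticMonoid) : Set PlacticMonoid :=
  {a | ∃ x w y : FreeMonoid Letter,
    (x * w * y).length ≤ n ∧ mk (x * w * y) = m ∧ mk w = a}

theorem factors_finite (n : ℕ) (m : PlacticMonoid) : (factors n m).Finite := by
  obtain ⟨L, hL⟩ := exists_index_le m
  refine ((words_finite n (L + n)).image mk).subset ?_
  rintro a ⟨x, w, y, hlen, hm, rfl⟩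
  refine ⟨w, ⟨?_, fun z hz => ?_⟩, rfl⟩
  · simp only [FreeMonoid.length_mul] at hlen
    omega
  · have := hL _ hm z (by simp [hz])
    omega

end PlacticMonoid

open PlacticMonoid

/-- The functions supported on elements of bounded length. -/
def boundedFunctions (R : Type*) [CommRing R] : Submodule R (PlacticMonoid → R) where
  carrier := {f | ∃ n, ∀ m, f m ≠ 0 → m ∈ lengthLE n}
  zero_mem' := ⟨0, fun m h => absurd rfl h⟩
  add_mem' := by
    rintro f g ⟨n, hf⟩ ⟨k, hg⟩
    refine ⟨max n k, fun m hm => ?_⟩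
    by_cases h : f m = 0
    · obtain ⟨w, hw, rfl⟩ := hg m fun h' => hm (by simp [h, h'])
      exact ⟨w, hw.trans (le_max_right _ _), rfl⟩
    · obtain ⟨w, hw, rfl⟩ := hf m h
      exact ⟨w, hw.trans (le_max_left _ _), rfl⟩
  smul_mem' := by
    rintro c f ⟨n, hf⟩
    exact ⟨n, fun m hm => hf m fun h => hm (by simp [h])⟩

/-- The completion of the plactic algebra: possibly infinite formal `R`-linear combinations
`∑ m, f m • [m]` of monomials of bounded length (`R = ℚ[t, t⁻¹]` below). -/
def PlacticCompletion (R : Type*) [CommRing R] : Type _ := boundedFunctions R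

namespace PlacticCompletion

variable {R : Type*} [CommRing R]

noncomputable instance : AddCommGroup (PlacticCompletion R) :=
  inferInstanceAs (AddCommGroup (boundedFunctions R))

noncomputable instance : Module R (PlacticCompletion R) :=
  inferInstanceAs (Module R (boundedFunctions R))

instance : FunLike (PlacticCompletion R) PlacticMonoid R where
  coe f := f.1
  coe_injective := Subtype.val_injective

@[ext]
theorem ext {f g : PlacticCompletion R} (h : ∀ m, f m = g m) : f = g := DFunLike.ext f g h

theorem bounded (f : PlacticCompletion R) : ∃ n, ∀ m, f m ≠ 0 → m ∈ lengthLE n := f.2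

theorem add_apply (f g : PlacticCompletion R) (m) : (f + g) m = f m + g m := rfl

theorem zero_apply (m) : (0 : PlacticCompletion R) m = 0 := rfl

theorem smul_apply (c : R) (f : PlacticCompletion R) (m) : (c • f) m = c * f m := rfl

open Classical in
/-- The product `(f g)(m) = ∑_{a b = m} f(a) g(b)`, a finite sum for `f`, `g` of bounded length. -/
noncomputable def mulFun (f g : PlacticMonoid → R) (m : PlacticMonoid) : R :=
  ∑ᶠ p : PlacticMonoid × PlacticMonoid, if p.1 * p.2 = m then f p.1 * g p.2 else 0

open Classical in
theorem mulFun_eq {f g : PlacticMonoid → R} {n k : ℕ} (hf : ∀ m, f m ≠ 0 → m ∈ lengthLE n)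
    (hg : ∀ m, g m ≠ 0 → m ∈ lengthLE k) (m : PlacticMonoid) (S : Finset PlacticMonoid)
    (hS : factors (n + k) m ⊆ S) :
    mulFun f g m = ∑ a ∈ S, ∑ b ∈ S, if a * b = m then f a * g b else 0 := by
  rw [mulFun, finsum_eq_sum_of_support_subset (s := S ×ˢ S), Finset.sum_product]
  rintro ⟨a, b⟩ hab
  simp only [Function.mem_support, ne_eq, ite_eq_right_iff, Classical.not_imp] at hab
  obtain ⟨rfl, hab⟩ := hab
  obtain ⟨x, hx, rfl⟩ := hf a (left_ne_zero_of_mul hab)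
  obtain ⟨y, hy, rfl⟩ := hg b (right_ne_zero_of_mul hab)
  simp only [Finset.coe_product, Set.mem_prod]
  exact ⟨hS ⟨1, x, y, by simp [FreeMonoid.length_mul]; omega, by simp, rfl⟩,
    hS ⟨x, y, 1, by simp [FreeMonoid.length_mul]; omega, by simp, rfl⟩⟩

open Classical in
theorem mulFun_bounded {f g : PlacticMonoid → R} {n k : ℕ} (hf : ∀ m, f m ≠ 0 → m ∈ lengthLE n)
    (hg : ∀ m, g m ≠ 0 → m ∈ lengthLE k) (m : PlacticMonoid) (hm : mulFun f g m ≠ 0) :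
    m ∈ lengthLE (n + k) := by
  obtain ⟨⟨a, b⟩, h⟩ : ∃ p : PlacticMonoid × PlacticMonoid,
      (if p.1 * p.2 = m then f p.1 * g p.2 else 0) ≠ 0 := by
    by_contra! h
    exact hm (finsum_eq_zero_of_forall_eq_zero h)
  simp only [ne_eq, ite_eq_right_iff, Classical.not_imp] at h
  obtain ⟨rfl, hab⟩ := h
  obtain ⟨x, hx, rfl⟩ := hf a (left_ne_zero_of_mul hab)
  obtain ⟨y, hy, rfl⟩ := hg b (right_ne_zero_of_mul hab)
  exact ⟨x * y, by simp [FreeMonoid.length_mul]; omega, by simp⟩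

noncomputable instance : Mul (PlacticCompletion R) where
  mul f g := ⟨mulFun f g, by
    obtain ⟨n, hf⟩ := f.bounded
    obtain ⟨k, hg⟩ := g.bounded
    exact ⟨n + k, mulFun_bounded hf hg⟩⟩

theorem mul_apply (f g : PlacticCompletion R) (m) : (f * g) m = mulFun f g m := rfl

theorem coe_mul (f g : PlacticCompletion R) : ⇑(f * g) = mulFun f g := rfl

open Classical in
/-- The monomial `[a]`. -/
noncomputable def single (a : PlacticMonoid) : PlacticCompletion R :=
  ⟨fun m => if m = a then 1 else 0, by
    obtain ⟨w, rfl⟩ : ∃ w, mk w = a := PresentedMonoid.surjective_mk a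
    refine ⟨w.length, fun m hm => ?_⟩
    simp only [ne_eq, ite_eq_right_iff, Classical.not_imp] at hm
    exact ⟨w, le_rfl, hm.1.symm⟩⟩

open Classical in
theorem single_apply (a m : PlacticMonoid) :
    (single a : PlacticCompletion R) m = if m = a then 1 else 0 := rfl

noncomputable instance : One (PlacticCompletion R) := ⟨single 1⟩

theorem one_def : (1 : PlacticCompletion R) = single 1 := rfl

theorem single_mul_single (a b : PlacticMonoid) :
    (single a * single b : PlacticCompletion R) = single (a * b) := by
  classical
  ext m
  rw [mul_apply, mulFun, finsum_eq_single _ (a, b), single_apply, single_apply, single_apply]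
  · simp [eq_comm]
  · rintro ⟨a', b'⟩ h
    by_cases ha : a' = a <;> by_cases hb : b' = b <;> simp_all [single_apply]

protected theorem mul_assoc' (f g h : PlacticCompletion R) : f * g * h = f * (g * h) := by
  classical
  obtain ⟨n, hf⟩ := f.bounded
  obtain ⟨k, hg⟩ := g.bounded
  obtain ⟨l, hh⟩ := h.bounded
  ext m
  set S := (factors_finite (n + k + l) m).toFinset with hS
  have memS : ∀ a, a ∈ S ↔ a ∈ factors (n + k + l) m := fun a => by simp [hS]
  have hfg := mulFun_bounded hf hg
  have hgh := mulFun_bounded hg hh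
  rw [mul_apply, coe_mul, mulFun_eq hfg hh m S fun a ha => (memS a).2 ha,
    mul_apply, coe_mul, mulFun_eq hf hgh m S fun a ha => (memS a).2 (by rwa [add_assoc])]
  have key₁ : ∀ d ∈ S, ∀ c ∈ S, (if d * c = m then mulFun f g d * h c else 0) =
      ∑ a ∈ S, ∑ b ∈ S, if a * b = d then (if a * b * c = m then f a * g b * h c else 0) else 0 := by
    intro d _ c _
    split_ifs with hm
    · by_cases hc : h c = 0
      · simp [hc]
      · obtain ⟨z, hz, rfl⟩ := hh c hc
        rw [mulFun_eq hf hg d S, Finset.sum_mul]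
        · refine Finset.sum_congr rfl fun a _ => ?_
          rw [Finset.sum_mul]
          refine Finset.sum_congr rfl fun b _ => ?_
          split_ifs with h1 h2 <;> simp_all
        · rintro _ ⟨x, w, y, hlen, rfl, rfl⟩
          refine (memS _).2 ⟨x, w, y * z, ?_, ?_, rfl⟩
          · simp only [FreeMonoid.length_mul] at hlen ⊢
            omega
          · rw [← hm, ← mul_assoc, map_mul]
    · symm
      refine Finset.sum_eq_zero fun a _ => Finset.sum_eq_zero fun b _ => ?_
      split_ifs with h1 h2
      · exact absurd (h1 ▸ h2) hm
      · rfl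
      · rfl
  have key₂ : ∀ a ∈ S, ∀ d ∈ S, (if a * d = m then f a * mulFun g h d else 0) =
      ∑ b ∈ S, ∑ c ∈ S, if b * c = d then (if a * b * c = m then f a * g b * h c else 0) else 0 := by
    intro a _ d _
    split_ifs with hm
    · by_cases ha : f a = 0
      · simp [ha]
      · obtain ⟨z, hz, rfl⟩ := hf a ha
        rw [mulFun_eq hg hh d S, Finset.mul_sum]
        · refine Finset.sum_congr rfl fun b _ => ?_
          rw [Finset.mul_sum]
          refine Finset.sum_congr rfl fun c _ => ?_
          split_ifs with h1 h2 <;> simp_all [mul_assoc]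
        · rintro _ ⟨x, w, y, hlen, rfl, rfl⟩
          refine (memS _).2 ⟨z * x, w, y, ?_, ?_, rfl⟩
          · simp only [FreeMonoid.length_mul] at hlen ⊢
            omega
          · rw [← hm, mul_assoc, mul_assoc, map_mul, ← mul_assoc x]
    · symm
      refine Finset.sum_eq_zero fun b _ => Finset.sum_eq_zero fun c _ => ?_
      split_ifs with h1 h2
      · exact absurd (by rw [← h1, ← mul_assoc]; exact h2) hm
      · rfl
      · rfl
  -- a nonzero triple has both partial products among the factors of `m`
  have trip : ∀ a b c, a * b * c = m → f a * g b * h c ≠ 0 → a * b ∈ S ∧ b * c ∈ S := by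
    intro a b c hm hne
    obtain ⟨x, hx, rfl⟩ := hf a (left_ne_zero_of_mul (left_ne_zero_of_mul hne))
    obtain ⟨y, hy, rfl⟩ := hg b (right_ne_zero_of_mul (left_ne_zero_of_mul hne))
    obtain ⟨z, hz, rfl⟩ := hh c (right_ne_zero_of_mul hne)
    refine ⟨(memS _).2 ⟨1, x * y, z, ?_, by simpa using hm, by simp⟩,
      (memS _).2 ⟨x, y * z, 1, ?_, by simpa [mul_assoc] using hm, by simp⟩⟩ <;>
      simp only [FreeMonoid.length_mul, FreeMonoid.length_one] <;> omega
  rw [Finset.sum_congr rfl fun d hd => Finset.sum_congr rfl (key₁ d hd),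
    Finset.sum_congr rfl fun a ha => Finset.sum_congr rfl (key₂ a ha)]
  trans ∑ a ∈ S, ∑ b ∈ S, ∑ c ∈ S, if a * b * c = m then f a * g b * h c else 0
  · calc _ = ∑ d ∈ S, ∑ a ∈ S, ∑ b ∈ S, ∑ c ∈ S,
          (if a * b = d then (if a * b * c = m then f a * g b * h c else 0) else 0) := by
          refine Finset.sum_congr rfl fun d _ => ?_
          rw [Finset.sum_comm]
          refine Finset.sum_congr rfl fun a _ => ?_
          rw [Finset.sum_comm]
      _ = _ := by
          rw [Finset.sum_comm]
          refine Finset.sum_congr rfl fun a _ => ?_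
          rw [Finset.sum_comm]
          refine Finset.sum_congr rfl fun b _ => ?_
          rw [Finset.sum_comm]
          refine Finset.sum_congr rfl fun c _ => ?_
          rw [Finset.sum_ite_eq]
          split_ifs with h1 h2 h2
          · rfl
          · rfl
          · by_contra hne
            exact h1 (trip a b c h2 (Ne.symm hne)).1
          · rfl
  · refine Finset.sum_congr rfl fun a _ => ?_
    symm
    rw [Finset.sum_comm]
    refine Finset.sum_congr rfl fun b _ => ?_
    rw [Finset.sum_comm]
    refine Finset.sum_congr rfl fun c _ => ?_
    rw [Finset.sum_ite_eq]
    split_ifs with h1 h2 h2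
    · rfl
    · rfl
    · by_contra hne
      exact h1 (trip a b c h2 (Ne.symm hne)).2
    · rfl

protected theorem add_mul' (f g h : PlacticCompletion R) : (f + g) * h = f * h + g * h := by
  classical
  obtain ⟨n, hf⟩ := f.bounded
  obtain ⟨k, hg⟩ := g.bounded
  obtain ⟨j, hfg⟩ := (f + g).bounded
  obtain ⟨l, hh⟩ := h.bounded
  ext m
  have hsub : ∀ i, i ≤ n + k + j + l → factors i m ⊆ (factors_finite (n + k + j + l) m).toFinset := by
    rintro i hi a ⟨x, w, y, hlen, h1, h2⟩
    simpa using ⟨x, w, y, hlen.trans hi, h1, h2⟩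
  rw [add_apply, mul_apply, mul_apply, mul_apply, mulFun_eq hfg hh m _ (hsub _ (by omega)),
    mulFun_eq hf hh m _ (hsub _ (by omega)), mulFun_eq hg hh m _ (hsub _ (by omega)),
    ← Finset.sum_add_distrib]
  refine Finset.sum_congr rfl fun a _ => ?_
  rw [← Finset.sum_add_distrib]
  refine Finset.sum_congr rfl fun b _ => ?_
  split_ifs
  · rw [add_apply, add_mul]
  · simp

protected theorem mul_add' (f g h : PlacticCompletion R) : f * (g + h) = f * g + f * h := by
  classical
  obtain ⟨n, hf⟩ := f.bounded
  obtain ⟨k, hg⟩ := g.bounded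
  obtain ⟨j, hgh⟩ := (g + h).bounded
  obtain ⟨l, hh⟩ := h.bounded
  ext m
  have hsub : ∀ i, i ≤ n + k + j + l → factors i m ⊆ (factors_finite (n + k + j + l) m).toFinset := by
    rintro i hi a ⟨x, w, y, hlen, h1, h2⟩
    simpa using ⟨x, w, y, hlen.trans hi, h1, h2⟩
  rw [add_apply, mul_apply, mul_apply, mul_apply, mulFun_eq hf hgh m _ (hsub _ (by omega)),
    mulFun_eq hf hg m _ (hsub _ (by omega)), mulFun_eq hf hh m _ (hsub _ (by omega)),
    ← Finset.sum_add_distrib]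
  refine Finset.sum_congr rfl fun a _ => ?_
  rw [← Finset.sum_add_distrib]
  refine Finset.sum_congr rfl fun b _ => ?_
  split_ifs
  · rw [add_apply, mul_add]
  · simp

protected theorem one_mul' (f : PlacticCompletion R) : 1 * f = f := by
  classical
  ext m
  rw [mul_apply, mulFun, finsum_eq_single _ (1, m)]
  · simp [one_def, single_apply]
  · rintro ⟨a, b⟩ h
    by_cases ha : a = 1 <;> by_cases hb : b = m <;> simp_all [one_def, single_apply]

protected theorem mul_one' (f : PlacticCompletion R) : f * 1 = f := by
  classical
  ext m
  rw [mul_apply, mulFun, finsum_eq_single _ (m, 1)]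
  · simp [one_def, single_apply]
  · rintro ⟨a, b⟩ h
    by_cases ha : a = m <;> by_cases hb : b = 1 <;> simp_all [one_def, single_apply]

protected theorem smul_mul' (c : R) (f g : PlacticCompletion R) : c • f * g = c • (f * g) := by
  classical
  obtain ⟨n, hf⟩ := f.bounded
  obtain ⟨k, hg⟩ := g.bounded
  have hcf : ∀ m, (c • f) m ≠ 0 → m ∈ lengthLE n := fun m hm =>
    hf m fun h => hm (by rw [smul_apply, h, mul_zero])
  ext m
  have hS : factors (n + k) m ⊆ (factors_finite (n + k) m).toFinset := by simp
  rw [smul_apply, mul_apply, mul_apply, mulFun_eq hcf hg m _ hS, mulFun_eq hf hg m _ hS,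
    Finset.mul_sum]
  refine Finset.sum_congr rfl fun a _ => ?_
  rw [Finset.mul_sum]
  refine Finset.sum_congr rfl fun b _ => ?_
  split_ifs
  · rw [smul_apply, mul_assoc]
  · simp

protected theorem mul_smul' (c : R) (f g : PlacticCompletion R) : f * c • g = c • (f * g) := by
  classical
  obtain ⟨n, hf⟩ := f.bounded
  obtain ⟨k, hg⟩ := g.bounded
  have hcg : ∀ m, (c • g) m ≠ 0 → m ∈ lengthLE k := fun m hm =>
    hg m fun h => hm (by rw [smul_apply, h, mul_zero])
  ext m
  have hS : factors (n + k) m ⊆ (factors_finite (n + k) m).toFinset := by simp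
  rw [smul_apply, mul_apply, mul_apply, mulFun_eq hf hcg m _ hS, mulFun_eq hf hg m _ hS,
    Finset.mul_sum]
  refine Finset.sum_congr rfl fun a _ => ?_
  rw [Finset.mul_sum]
  refine Finset.sum_congr rfl fun b _ => ?_
  split_ifs
  · rw [smul_apply, mul_left_comm]
  · simp

noncomputable instance : Ring (PlacticCompletion R) :=
  { (inferInstance : AddCommGroup (PlacticCompletion R)) with
    mul := (· * ·)
    one := 1
    mul_assoc := PlacticCompletion.mul_assoc'
    one_mul := PlacticCompletion.one_mul'
    mul_one := PlacticCompletion.mul_one'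
    left_distrib := PlacticCompletion.mul_add'
    right_distrib := PlacticCompletion.add_mul'
    zero_mul := fun f => by
      have h := PlacticCompletion.add_mul' 0 0 f
      rw [add_zero] at h
      exact left_eq_add.1 h
    mul_zero := fun f => by
      have h := PlacticCompletion.mul_add' f 0 0
      rw [add_zero] at h
      exact left_eq_add.1 h }

noncomputable instance : Algebra R (PlacticCompletion R) :=
  Algebra.ofModule PlacticCompletion.smul_mul' PlacticCompletion.mul_smul'

/-- Coefficientwise convergence, the coefficients being discrete. -/
instance : TopologicalSpace (PlacticCompletion R) :=
  TopologicalSpace.induced (fun f => (f : PlacticMonoid → R))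
    (@Pi.topologicalSpace PlacticMonoid (fun _ => R) fun _ => ⊥)

end PlacticCompletion


namespace PlacticAlgebra

/-- The embedding of the plactic algebra into its completion: `u i ↦ t • [u i]`, `v i ↦ [v i]`. -/
noncomputable def toCompletion : PlacticAlgebra →ₐ[ℚ[T;T⁻¹]] PlacticCompletion ℚ[T;T⁻¹] :=
  RingQuot.liftAlgHom ℚ[T;T⁻¹] ⟨FreeAlgebra.lift ℚ[T;T⁻¹] fun
    | .pos i => (LaurentPolynomial.T 1 : ℚ[T;T⁻¹]) • PlacticCompletion.single (PlacticMonoid.u i)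
    | .dual i => PlacticCompletion.single (PlacticMonoid.v i), by
    intro x y h
    have mk_rel : ∀ {a b : FreeMonoid Letter}, PlacticRel (N := FreeMonoid Letter)
        (fun i => .of (.pos i)) (fun i => .of (.dual i)) 1 a b → mk a = mk b :=
      fun h => PresentedMonoid.mk_eq_mk_of_rel h
    cases h <;> simp only [map_mul, FreeAlgebra.lift_ι_apply, smul_mul_assoc, mul_smul_comm,
      PlacticCompletion.single_mul_single, PlacticMonoid.u, PlacticMonoid.v,
      Algebra.algebraMap_eq_smul_one] <;>
      simp only [← map_mul]
    case knuth₁ h₁ h₂ => rw [mk_rel (.knuth₁ h₁ h₂)]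
    case knuth₁_dual h₁ h₂ => rw [mk_rel (.knuth₁_dual h₁ h₂)]
    case knuth₂ h₁ h₂ => rw [mk_rel (.knuth₂ h₁ h₂)]
    case knuth₂_dual h₁ h₂ => rw [mk_rel (.knuth₂_dual h₁ h₂)]
    case shift i => rw [mk_rel (.shift i)]
    case contract => rw [mk_rel .contract, map_one, map_smul, map_one, PlacticCompletion.one_def]
    case comm h => rw [mk_rel (.comm h)]⟩

theorem toCompletion_u (i : ℕ) : toCompletion (u i) =
    (LaurentPolynomial.T 1 : ℚ[T;T⁻¹]) • PlacticCompletion.single (PlacticMonoid.u i) := by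
  simp [toCompletion, u]

theorem toCompletion_v (i : ℕ) :
    toCompletion (v i) = PlacticCompletion.single (PlacticMonoid.v i) := by
  simp [toCompletion, v]

/-- The monomials `t⁻¹ u i`, `v i` and their products: these represent `PlacticMonoid`. -/
noncomputable def normalized : PlacticMonoid →* PlacticAlgebra :=
  PresentedMonoid.lift (fun
    | .pos i => (LaurentPolynomial.T (-1) : ℚ[T;T⁻¹]) • u i
    | .dual i => v i) <| by
    have rel : ∀ {a b}, PlacticRel (N := FreeAlgebra ℚ[T;T⁻¹] Letter)
      (fun i => FreeAlgebra.ι ℚ[T;T⁻¹] (Letter.pos i))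
      (fun i => FreeAlgebra.ι ℚ[T;T⁻¹] (Letter.dual i))
      (algebraMap ℚ[T;T⁻¹] (FreeAlgebra ℚ[T;T⁻¹] Letter) (LaurentPolynomial.T 1)) a b →
      RingQuot.mkAlgHom ℚ[T;T⁻¹] _ a = RingQuot.mkAlgHom ℚ[T;T⁻¹] _ b :=
      fun h => RingQuot.mkAlgHom_rel _ h
    intro x y h
    cases h <;> simp only [map_mul, map_one, FreeMonoid.lift_eval_of, smul_mul_assoc,
      mul_smul_comm, u, v] <;> simp only [← map_mul]
    case knuth₁ h₁ h₂ => rw [rel (.knuth₁ h₁ h₂)]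
    case knuth₁_dual h₁ h₂ => rw [rel (.knuth₁_dual h₁ h₂)]
    case knuth₂ h₁ h₂ => rw [rel (.knuth₂ h₁ h₂)]
    case knuth₂_dual h₁ h₂ => rw [rel (.knuth₂_dual h₁ h₂)]
    case shift i => rw [rel (.shift i)]
    case contract =>
      rw [rel .contract, AlgHom.commutes,
        Algebra.algebraMap_eq_smul_one (A := PlacticAlgebra) (LaurentPolynomial.T 1), smul_smul,
        ← LaurentPolynomial.T_add]
      simp
    case comm h => rw [rel (.comm h)]

theorem toCompletion_normalized (m : PlacticMonoid) :
    toCompletion (normalized m) = PlacticCompletion.single m := by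
  obtain ⟨w, rfl⟩ : ∃ w, mk w = m := PresentedMonoid.surjective_mk m
  induction w using FreeMonoid.inductionOn' with
  | one => simp [PlacticCompletion.one_def]
  | of_mul x w ih =>
    rw [map_mul, map_mul, map_mul, ih, ← PlacticCompletion.single_mul_single]
    congr 1
    cases x with
    | pos i =>
      change toCompletion ((LaurentPolynomial.T (-1) : ℚ[T;T⁻¹]) • u i) = _
      rw [map_smul, toCompletion_u, smul_smul, ← LaurentPolynomial.T_add]
      simp [PlacticMonoid.u]
    | dual i => exact toCompletion_v i

theorem span_normalized : Submodule.span ℚ[T;T⁻¹] (Set.range normalized) = ⊤ := by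
  have h : (MonoidAlgebra.lift ℚ[T;T⁻¹] PlacticAlgebra PlacticMonoid normalized).range = ⊤ := by
    rw [eq_top_iff]
    rintro x -
    obtain ⟨x, rfl⟩ := RingQuot.mkAlgHom_surjective ℚ[T;T⁻¹] _ x
    induction x using FreeAlgebra.induction with
    | grade0 r => rw [AlgHom.commutes]; exact Subalgebra.algebraMap_mem _ r
    | grade1 x =>
      cases x with
      | pos i =>
        refine ⟨MonoidAlgebra.single (PlacticMonoid.u i) (LaurentPolynomial.T 1), ?_⟩
        simp only [AlgHom.toRingHom_eq_coe, RingHom.coe_coe, MonoidAlgebra.lift_single]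
        change (LaurentPolynomial.T 1 : ℚ[T;T⁻¹]) • (LaurentPolynomial.T (-1) : ℚ[T;T⁻¹]) • u i = u i
        rw [smul_smul, ← LaurentPolynomial.T_add]
        simp
      | dual i =>
        refine ⟨MonoidAlgebra.single (PlacticMonoid.v i) 1, ?_⟩
        simp only [AlgHom.toRingHom_eq_coe, RingHom.coe_coe, MonoidAlgebra.lift_single]
        change (1 : ℚ[T;T⁻¹]) • v i = v i
        rw [one_smul]
    | mul x y hx hy => rw [map_mul]; exact mul_mem hx hy
    | add x y hx hy => rw [map_add]; exact add_mem hx hy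
  rw [eq_top_iff]
  rintro x -
  obtain ⟨y, rfl⟩ : x ∈ (MonoidAlgebra.lift ℚ[T;T⁻¹] PlacticAlgebra PlacticMonoid normalized).range :=
    h ▸ Algebra.mem_top
  change MonoidAlgebra.lift ℚ[T;T⁻¹] PlacticAlgebra PlacticMonoid normalized y ∈ _
  rw [MonoidAlgebra.lift_apply]
  exact Submodule.sum_mem _ fun m _ => Submodule.smul_mem _ _ (Submodule.subset_span ⟨m, rfl⟩)

/-- With `span_normalized`: the plactic algebra is the algebra of finitely supported elements of the
completion. -/
theorem toCompletion_injective : Function.Injective toCompletion := by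
  classical
  rw [injective_iff_map_eq_zero]
  intro x hx
  have hmem : x ∈ Submodule.span ℚ[T;T⁻¹] (Set.range normalized) :=
    span_normalized ▸ Submodule.mem_top
  obtain ⟨c, rfl⟩ := Finsupp.mem_span_range_iff_exists_finsupp.1 hmem
  have happly : ∀ (s : Finset PlacticMonoid) (F : PlacticMonoid → PlacticCompletion ℚ[T;T⁻¹]) (m),
      (∑ a ∈ s, F a) m = ∑ a ∈ s, F a m := fun s F m => by
    induction s using Finset.induction with
    | empty => rfl
    | insert a s ha ih => rw [Finset.sum_insert ha, Finset.sum_insert ha,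
        PlacticCompletion.add_apply, ih]
  have hc : c = 0 := by
    ext1 m
    have h := congrArg (fun f : PlacticCompletion ℚ[T;T⁻¹] => f m) hx
    simp only [Finsupp.sum, map_sum, map_smul, toCompletion_normalized, happly,
      PlacticCompletion.smul_apply, PlacticCompletion.single_apply,
      PlacticCompletion.zero_apply] at h
    simpa using h
  simp [hc]

end PlacticAlgebra

section SchurOperators

open Classical in
/-- Add a box at the end of row `i`, if the result is a Young diagram. -/
noncomputable def addBox (i : ℕ) (μ : YoungDiagram) : Option YoungDiagram :=
  if h : IsLowerSet (↑(insert (i, μ.rowLen i) μ.cells) : Set (ℕ × ℕ)) then some ⟨_, h⟩ else none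

open Classical in
/-- Remove the last box of row `i`, if there is one and the result is a Young diagram. -/
noncomputable def removeBox (i : ℕ) (μ : YoungDiagram) : Option YoungDiagram :=
  if h : 0 < μ.rowLen i ∧ IsLowerSet (↑(μ.cells.erase (i, μ.rowLen i - 1)) : Set (ℕ × ℕ)) then
    some ⟨_, h.2⟩ else none

/-- The `R`-module of symmetric functions, through its basis of Schur functions: the basis vector
`Finsupp.single μ 1` is the Schur function of `μ`. -/
abbrev SchurModule (R : Type*) [CommRing R] : Type _ := YoungDiagram →₀ R

/-- Pointwise convergence of operators, the module being discrete. -/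
noncomputable instance (R : Type*) [CommRing R] : TopologicalSpace (Module.End R (SchurModule R)) :=
  TopologicalSpace.induced (fun f => (f : SchurModule R → SchurModule R))
    (@Pi.topologicalSpace (SchurModule R) (fun _ => SchurModule R) fun _ => ⊥)

/-- The Schur operator `ū_{i+1}`: `s_μ ↦ t s_{μ - box in row i}`, or `0`. -/
noncomputable def schurDown {R : Type*} [CommRing R] (t : R) (i : ℕ) :
    Module.End R (SchurModule R) :=
  Finsupp.linearCombination R fun μ => (removeBox i μ).elim 0 fun ν => Finsupp.single ν t

/-- The Schur operator `ū_{(i+1)^∨}`: `s_μ ↦ s_{μ + box in row i}`, or `0`. -/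
noncomputable def schurUp (R : Type*) [CommRing R] (i : ℕ) : Module.End R (SchurModule R) :=
  Finsupp.linearCombination R fun μ => (addBox i μ).elim 0 fun ν => Finsupp.single ν 1

end SchurOperators

section CauchyProducts

open Filter Topology

/-! Limits of power series are taken coefficientwise, in the topology of the coefficient ring. -/

variable {E : Type*} [Ring E] [TopologicalSpace E] {σ : Type*}

/-- The power series `z_i x`, for a variable `x` commuting with the coefficients. -/
noncomputable def linTerm (z : ℕ → E) (x : σ) (i : ℕ) : MvPowerSeries σ E :=
  MvPowerSeries.monomial (Finsupp.single x 1) (z i)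

/-- `F` is the series `𝒬(x)` for a variable `x` of degree `ε`: the infinite product
`(1 + u_0 x)(1 + u_1 x)(1 + u_2 x)⋯` if `ε = 1`, and the inverse of
`(1 - u_0 x)(1 - u_1 x)(1 - u_2 x)⋯` if `ε = 0`. -/
def IsQFactor (u : ℕ → E) (x : σ) (ε : ZMod 2) (F : MvPowerSeries σ E) : Prop :=
  if ε = 0 then
    ∃ G, Tendsto (fun n => ((List.range n).map fun i => 1 - linTerm u x i).prod) atTop (𝓝 G) ∧
      F * G = 1 ∧ G * F = 1
  else Tendsto (fun n => ((List.range n).map fun i => 1 + linTerm u x i).prod) atTop (𝓝 F)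

/-- `F` is the series `𝒫(x)` for a variable `x` of degree `ε`: the infinite product
`⋯(1 + v_2 x)(1 + v_1 x)(1 + v_0 x)` if `ε = 1`, and the inverse of
`⋯(1 - v_2 x)(1 - v_1 x)(1 - v_0 x)` if `ε = 0`. -/
def IsPFactor (v : ℕ → E) (x : σ) (ε : ZMod 2) (F : MvPowerSeries σ E) : Prop :=
  if ε = 0 then
    ∃ G, Tendsto (fun n => ((List.range n).reverse.map fun i => 1 - linTerm v x i).prod) atTop (𝓝 G) ∧
      F * G = 1 ∧ G * F = 1
  else Tendsto (fun n => ((List.range n).reverse.map fun i => 1 + linTerm v x i).prod) atTop (𝓝 F)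

/-- `F` is the product of the `f a`, in increasing order of `a` from left to right: the limit of the
ordered products over finite subsets. -/
def IsOrderedProd {A : Type*} [LinearOrder A] (f : A → MvPowerSeries σ E)
    (F : MvPowerSeries σ E) : Prop :=
  Tendsto (fun s : Finset A => ((s.sort (· ≤ ·)).map f).prod) atTop (𝓝 F)

/-- `F` is the Cauchy product `𝒬(x_A)`, the ordered product of the `𝒬(x_a)`. -/
def IsCauchyQ {A : Type*} [LinearOrder A] (u : ℕ → E) (x : A → σ) (d : A → ZMod 2)
    (F : MvPowerSeries σ E) : Prop :=
  ∃ f : A → MvPowerSeries σ E, (∀ a, IsQFactor u (x a) (d a) (f a)) ∧ IsOrderedProd f F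

/-- `F` is the Cauchy product `𝒫(x_B)`, the ordered product of the `𝒫(x_b)`. -/
def IsCauchyP {B : Type*} [LinearOrder B] (v : ℕ → E) (x : B → σ) (d : B → ZMod 2)
    (F : MvPowerSeries σ E) : Prop :=
  ∃ f : B → MvPowerSeries σ E, (∀ b, IsPFactor v (x b) (d b) (f b)) ∧ IsOrderedProd f F

/-- `K = ∏_{|a| ≠ |b|} (1 + t x_a x_b) / ∏_{|a| = |b|} (1 - t x_a x_b)`. The denominator has constant
term `1`, so it is invertible. -/
def IsCauchyKernel {R A B : Type*} [CommRing R] (t : R) (dA : A → ZMod 2) (dB : B → ZMod 2)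
    (K : MvPowerSeries (A ⊕ B) R) : Prop :=
  letI : TopologicalSpace R := ⊥
  ∃ N D : MvPowerSeries (A ⊕ B) R,
    HasProd (fun p : {p : A × B // dA p.1 ≠ dB p.2} =>
      1 + MvPowerSeries.C t * MvPowerSeries.X (.inl p.1.1) * MvPowerSeries.X (.inr p.1.2)) N ∧
    HasProd (fun p : {p : A × B // dA p.1 = dB p.2} =>
      1 - MvPowerSeries.C t * MvPowerSeries.X (.inl p.1.1) * MvPowerSeries.X (.inr p.1.2)) D ∧
    K * D = N

end CauchyProducts

end PlacticCauchy

open PlacticCauchy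

/-! Everything reduces to one variable `x` for the letters `u i` and one variable `y` for the
letters `v i`. Put `a i = p [u i] x` and `b i = q [v i] y` with scalars `p`, `q`. The relations
between the two families say that `b i * a i = a (i + 1) * b (i + 1)`, that `a i` and `b j` commute
for `i ≠ j`, and that `a 0 * b 0` is the central series `p q x y`. With `w i = (1 - a i * b i)⁻¹`,
expansion gives the local exchange `(1 + a i) * w (i + 1) * (1 + b i) = (1 + b i) * w i * (1 + a i)`
(`one_add_mul_inv_mul_one_add`). Applied from the innermost pair outwards, it reverses the order of
`(1 + a 0)⋯(1 + a (n-1))` and `(1 + b (n-1))⋯(1 + b 0)` and turns the `w n` between them into the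
central `w 0` (`prod_exchange`). As `n` grows, `w n` tends to `1`; the limits `U`, `V` satisfy `U *
V * (1 - p q x y) = V * U` (`uProd_mul_vProd`).

The four combinations of degrees come from `p = ±t`, `q = ±1` and inversion of the factors of degree
`0` (`uFactor_mul_vFactor`). Collecting the central factors gives the identity for finite products,
and then for their limits (`exists_cauchy_identity`).

The limits are controlled by length. The coefficient at exponent `d` is a series of monomials of
length at most `d.degree`, and a word of length `n` representing `m` has letters of index at most `L
+ n`, with `L` depending on `m` only (`exists_index_le`). Hence letters of large index cannot affect
the coefficient of `m` in a product; `FactorAgree` makes this precise.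

For the Schur operators, a Young diagram is encoded by its numbers of columns of each length. A
letter moves a token between neighbouring places, and a word acts on the diagram exactly when it
acts at every place. The action at a place respects the plactic relations (`token`), therefore so do
the Schur operators (`wordStep_eq_of_mk_eq`). The bound on indices shows moreover that a given
vector is killed by all but finitely many monomials of bounded length, so the action extends to the
completion and carries the identity over. All this works over any commutative ring `R` with any `t`;
the case `R = ℚ`, `t = 1` is a second instance. -/

namespace PlacticCauchy

open Filter Topology

/-! ### Power series truncated below an exponent -/

section AgreeUpTo

variable {E : Type*} [Ring E] {σ : Type*}

/-- Equality of the coefficients of all monomials that divide `x ^ d`. -/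
def AgreeUpTo (d : σ →₀ ℕ) (F G : MvPowerSeries σ E) : Prop :=
  ∀ e ≤ d, MvPowerSeries.coeff e F = MvPowerSeries.coeff e G

namespace AgreeUpTo

variable {d : σ →₀ ℕ} {F F' G G' : MvPowerSeries σ E}

theorem refl (d : σ →₀ ℕ) (F : MvPowerSeries σ E) : AgreeUpTo d F F := fun _ _ => rfl

theorem symm (h : AgreeUpTo d F G) : AgreeUpTo d G F := fun e he => (h e he).symm

theorem trans (h : AgreeUpTo d F F') (h' : AgreeUpTo d F' G) : AgreeUpTo d F G :=
  fun e he => (h e he).trans (h' e he)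

theorem add (h : AgreeUpTo d F F') (h' : AgreeUpTo d G G') :
    AgreeUpTo d (F + G) (F' + G') := fun e he => by
  rw [map_add, map_add, h e he, h' e he]

theorem sub (h : AgreeUpTo d F F') (h' : AgreeUpTo d G G') :
    AgreeUpTo d (F - G) (F' - G') := fun e he => by
  rw [map_sub, map_sub, h e he, h' e he]

theorem mul (h : AgreeUpTo d F F') (h' : AgreeUpTo d G G') :
    AgreeUpTo d (F * G) (F' * G') := by
  classical
  intro e he
  rw [MvPowerSeries.coeff_mul, MvPowerSeries.coeff_mul]
  refine Finset.sum_congr rfl fun p hp => ?_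
  rw [Finset.HasAntidiagonal.mem_antidiagonal] at hp
  rw [h p.1 ((hp ▸ le_self_add).trans he), h' p.2 ((hp ▸ le_add_self).trans he)]

theorem map {E' : Type*} [Ring E'] (φ : E →+* E') (h : AgreeUpTo d F G) :
    AgreeUpTo d (MvPowerSeries.map φ F) (MvPowerSeries.map φ G) := fun e he => by
  rw [MvPowerSeries.coeff_map, MvPowerSeries.coeff_map, h e he]

theorem one_of_mul_eq_one (h : AgreeUpTo d G 1) (hFG : F * G = 1) : AgreeUpTo d F 1 := by
  have := (refl d F).mul h
  rw [hFG, mul_one] at this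
  exact this.symm

theorem list_prod_one (l : List (MvPowerSeries σ E)) (h : ∀ F ∈ l, AgreeUpTo d F 1) :
    AgreeUpTo d l.prod 1 := by
  induction l with
  | nil => exact refl d 1
  | cons F l ih =>
    rw [List.prod_cons, ← mul_one (1 : MvPowerSeries σ E)]
    exact (h F (by simp)).mul (ih fun G hG => h G (by simp [hG]))

theorem list_prod_filter {A : Type*} (f : A → MvPowerSeries σ E) (p : A → Prop) [DecidablePred p]
    (h : ∀ a, ¬ p a → AgreeUpTo d (f a) 1) (l : List A) :
    AgreeUpTo d (l.map f).prod ((l.filter p).map f).prod := by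
  induction l with
  | nil => exact refl d 1
  | cons a l ih =>
    by_cases ha : p a
    · simpa [ha] using (refl d (f a)).mul ih
    · simpa [ha] using (h a ha).mul ih

theorem monomial_zero {e : σ →₀ ℕ} (he : ¬ e ≤ d) (c : E) :
    AgreeUpTo d (MvPowerSeries.monomial e c) 0 := by
  classical
  intro e' he'
  rw [MvPowerSeries.coeff_monomial, if_neg (by rintro rfl; exact he he'), map_zero]

end AgreeUpTo

variable {ι : Type*} {l : Filter ι}

/-- Eventual constancy of each coefficient is stronger than convergence: the limit so obtained is a
limit for every topology on `E`. -/
theorem exists_eventually_agreeUpTo {F : ι → MvPowerSeries σ E}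
    (h : ∀ d, ∃ r, ∀ᶠ i in l, MvPowerSeries.coeff d (F i) = r) :
    ∃ G, ∀ d, ∀ᶠ i in l, AgreeUpTo d G (F i) := by
  classical
  choose r hr using h
  refine ⟨fun d => r d, fun d => ?_⟩
  -- Only finitely many exponents lie below `d`, so their thresholds can be combined.
  have := (eventually_all_finite (Set.finite_Icc 0 d)).2 fun e _ => hr e
  filter_upwards [this] with i hi e he
  exact (hi e ⟨zero_le, he⟩).symm

theorem tendsto_of_eventually_agreeUpTo [TopologicalSpace E] {F : ι → MvPowerSeries σ E}
    {G : MvPowerSeries σ E} (h : ∀ d, ∀ᶠ i in l, AgreeUpTo d G (F i)) : Tendsto F l (𝓝 G) := by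
  rw [MvPowerSeries.WithPiTopology.tendsto_iff_coeff_tendsto]
  intro d
  refine tendsto_const_nhds.congr' ?_
  filter_upwards [h d] with i hi
  exact hi d le_rfl

theorem eq_of_agreeUpTo {F G : MvPowerSeries σ E} (h : ∀ d, AgreeUpTo d F G) : F = G :=
  MvPowerSeries.ext fun d => h d d le_rfl

end AgreeUpTo

/-! ### Ordered infinite products with locally finite factors -/

section OrderedProducts

variable {E : Type*} [Ring E] {σ : Type*} {A : Type*}

theorem sort_filter [LinearOrder A] (s : Finset A) (p : A → Prop) [DecidablePred p] :
    (s.filter p).sort (· ≤ ·) = (s.sort (· ≤ ·)).filter p := by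
  refine List.Perm.eq_of_pairwise' (r := (· ≤ ·)) (Finset.pairwise_sort _ _)
    ((Finset.pairwise_sort s (· ≤ ·)).filter _) ?_
  refine (List.perm_ext_iff_of_nodup (Finset.sort_nodup _ _)
    ((Finset.sort_nodup s (· ≤ ·)).filter _)).2 fun a => ?_
  simp

/-- The ordered product of the `f a` over `a ∈ s`. -/
noncomputable def sortedProd [LinearOrder A] (f : A → MvPowerSeries σ E) (s : Finset A) :
    MvPowerSeries σ E :=
  ((s.sort (· ≤ ·)).map f).prod

/-- Up to each exponent, all but finitely many `f a` are `1`. -/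
def LocallyFiniteFactors (f : A → MvPowerSeries σ E) : Prop :=
  ∀ d, {a | ¬ AgreeUpTo d (f a) 1}.Finite

/-- Factors that are `1` up to `d` can be deleted without changing the product up to `d`. Once `s`
contains the finitely many other factors, what remains no longer depends on `s`. -/
theorem LocallyFiniteFactors.exists_sortedProd_limit [LinearOrder A] {f : A → MvPowerSeries σ E}
    (hf : LocallyFiniteFactors f) :
    ∃ F, ∀ d, ∀ᶠ s in atTop, AgreeUpTo d F (sortedProd f s) := by
  classical
  refine exists_eventually_agreeUpTo fun d =>
    ⟨MvPowerSeries.coeff d (sortedProd f (hf d).toFinset), ?_⟩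
  filter_upwards [eventually_ge_atTop (hf d).toFinset] with s hs
  have h := AgreeUpTo.list_prod_filter (d := d) f (· ∈ (hf d).toFinset)
    (fun a ha => by simpa using ha) (s.sort (· ≤ ·)) d le_rfl
  rw [← sort_filter, Finset.filter_mem_eq_inter, Finset.inter_eq_right.2 hs] at h
  exact h

theorem LocallyFiniteFactors.exists_prod_limit {R : Type*} [CommRing R]
    {f : A → MvPowerSeries σ R} (hf : LocallyFiniteFactors f) :
    ∃ F, ∀ d, ∀ᶠ s : Finset A in atTop, AgreeUpTo d F (∏ a ∈ s, f a) := by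
  classical
  refine exists_eventually_agreeUpTo fun d =>
    ⟨MvPowerSeries.coeff d (∏ a ∈ (hf d).toFinset, f a), ?_⟩
  filter_upwards [eventually_ge_atTop (hf d).toFinset] with s hs
  have h := AgreeUpTo.list_prod_filter (d := d) f (· ∈ (hf d).toFinset)
    (fun a ha => by simpa using ha) s.toList d le_rfl
  have h2 : ((s.toList.filter (· ∈ (hf d).toFinset)).map f).prod =
      ∏ a ∈ (hf d).toFinset, f a := by
    rw [← Finset.prod_map_toList]
    refine (List.Perm.map f ?_).prod_eq
    refine (List.perm_ext_iff_of_nodup ((Finset.nodup_toList s).filter _)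
      (Finset.nodup_toList _)).2 fun a => ?_
    simp only [List.mem_filter, Finset.mem_toList, decide_eq_true_eq, and_iff_right_iff_imp]
    exact fun ha => hs ha
  rwa [h2, Finset.prod_map_toList] at h

theorem sortedProd_map {E' : Type*} [Ring E'] [LinearOrder A] (φ : E →+* E')
    (f : A → MvPowerSeries σ E) (s : Finset A) :
    sortedProd (fun a => MvPowerSeries.map φ (f a)) s = MvPowerSeries.map φ (sortedProd f s) := by
  rw [sortedProd, sortedProd, map_list_prod, List.map_map]
  rfl

theorem isOrderedProd_of_eventually_agreeUpTo [TopologicalSpace E] [LinearOrder A]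
    {f : A → MvPowerSeries σ E} {F : MvPowerSeries σ E}
    (h : ∀ d, ∀ᶠ s in atTop, AgreeUpTo d F (sortedProd f s)) : IsOrderedProd f F :=
  tendsto_of_eventually_agreeUpTo h

end OrderedProducts

/-! ### Commutation of lists up to central factors -/

section TwistedCommutation

variable {M C : Type*} [Ring M] [CommRing C] {A B : Type*}

/-- The scalars `D` and `N` stay on their own sides of the equation. Being central, they can be
pulled out at each step, and no denominator has to be inverted. -/
theorem mul_list_prod_twisted (φ : C →+* M) (hφ : ∀ c x, Commute (φ c) x) (x : M) (g : B → M)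
    (D N : B → C)
    (h : ∀ b, x * g b * φ (D b) = g b * x * φ (N b)) (l : List B) :
    x * (l.map g).prod * φ (l.map D).prod = (l.map g).prod * x * φ (l.map N).prod := by
  induction l with
  | nil => simp
  | cons b l ih =>
    simp only [List.map_cons, List.prod_cons, map_mul]
    calc x * (g b * (l.map g).prod) * (φ (D b) * φ (l.map D).prod)
        = x * g b * ((l.map g).prod * φ (D b)) * φ (l.map D).prod := by simp only [mul_assoc]
      _ = x * g b * φ (D b) * (l.map g).prod * φ (l.map D).prod := by
          rw [← (hφ (D b) (l.map g).prod).eq]; simp only [mul_assoc]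
      _ = g b * x * (φ (N b) * ((l.map g).prod * φ (l.map D).prod)) := by
          rw [h]; simp only [mul_assoc]
      _ = g b * (x * (l.map g).prod * φ (l.map D).prod) * φ (N b) := by
          rw [(hφ (N b) _).eq]; simp only [mul_assoc]
      _ = g b * ((l.map g).prod * x) * (φ (l.map N).prod * φ (N b)) := by
          rw [ih]; simp only [mul_assoc]
      _ = _ := by rw [(hφ (N b) _).eq]; simp only [mul_assoc]

theorem list_prod_mul_list_prod_twisted (φ : C →+* M)
    (hφ : ∀ c x, Commute (φ c) x) (f : A → M) (g : B → M) (D N : A → B → C)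
    (h : ∀ a b, f a * g b * φ (D a b) = g b * f a * φ (N a b)) (k : List A) (l : List B) :
    (k.map f).prod * (l.map g).prod * φ (k.map fun a => (l.map (D a)).prod).prod =
      (l.map g).prod * (k.map f).prod * φ (k.map fun a => (l.map (N a)).prod).prod := by
  induction k with
  | nil => simp
  | cons a k ih =>
    have ha := mul_list_prod_twisted φ hφ (f a) g (D a) (N a) (h a) l
    simp only [List.map_cons, List.prod_cons, map_mul]
    set G := (l.map g).prod
    set K := (k.map f).prod
    set Da := φ (l.map (D a)).prod
    set Na := φ (l.map (N a)).prod
    set Dk := φ (k.map fun a => (l.map (D a)).prod).prod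
    set Nk := φ (k.map fun a => (l.map (N a)).prod).prod
    have hDa : ∀ x, Commute Da x := fun x => hφ _ x
    have hNa : ∀ x, Commute Na x := fun x => hφ _ x
    have hNk : ∀ x, Commute Nk x := fun x => hφ _ x
    change f a * K * G * (Da * Dk) = G * (f a * K) * (Na * Nk)
    calc f a * K * G * (Da * Dk) = f a * (K * G * Dk) * Da := by
          rw [(hDa Dk).eq]; simp only [mul_assoc]
      _ = f a * G * (K * (Nk * Da)) := by rw [ih]; simp only [mul_assoc]
      _ = f a * G * Da * (K * Nk) := by
          rw [← (hDa Nk).eq, ← mul_assoc K, ← (hDa K).eq]; simp only [mul_assoc]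
      _ = G * f a * (Na * K) * Nk := by rw [ha]; simp only [mul_assoc]
      _ = _ := by rw [(hNa K).eq]; simp only [mul_assoc]

end TwistedCommutation

end PlacticCauchy

namespace PlacticCauchy

open Filter Topology PlacticMonoid

/-! ### The exchange identity for finite products -/

section FiniteExchange

variable {M : Type*} [Ring M]

/-- The inverses intertwine: `a * w' = w * a` and `w' * b = b * w`. Since `w * (a * b) = w - 1` and
`w' * (b * a) = w' - 1`, both sides expand to `w + w' - 1 + w * a + b * w`. -/
theorem one_add_mul_inv_mul_one_add {a b w w' : M} (hw : w * (1 - a * b) = 1)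
    (hw₂ : (1 - a * b) * w = 1) (hw' : w' * (1 - b * a) = 1) (hw'₂ : (1 - b * a) * w' = 1) :
    (1 + a) * w' * (1 + b) = (1 + b) * w * (1 + a) := by
  have h₁ : a * w' = w * a := by
    calc a * w' = w * (1 - a * b) * a * w' := by rw [hw, one_mul]
      _ = w * a * ((1 - b * a) * w') := by noncomm_ring
      _ = w * a := by rw [hw'₂, mul_one]
  have h₂ : w' * b = b * w := by
    calc w' * b = w' * b * ((1 - a * b) * w) := by rw [hw₂, mul_one]
      _ = w' * (1 - b * a) * b * w := by noncomm_ring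
      _ = b * w := by rw [hw', one_mul]
  have h₃ : w * (a * b) = w - 1 := by rw [← hw]; noncomm_ring
  have h₄ : w' * (b * a) = w' - 1 := by rw [← hw']; noncomm_ring
  calc (1 + a) * w' * (1 + b) = w' + a * w' + w' * b + a * w' * b := by noncomm_ring
    _ = w' + w * a + b * w + w * (a * b) := by rw [h₁, h₂]; noncomm_ring
    _ = w + b * w + w * a + w' * (b * a) := by rw [h₃, h₄]; abel
    _ = w + b * w + w * a + w' * b * a := by rw [mul_assoc w']
    _ = (1 + b) * w * (1 + a) := by rw [h₂]; noncomm_ring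

/-- The innermost pair `1 + a n`, `1 + b n` encloses `w (n + 1)`. The local exchange swaps the two
and leaves `w n`; they then commute past all factors of smaller index, and `w n` is enclosed by the
next pair. -/
theorem prod_exchange (a b w : ℕ → M) (hba : ∀ i, b i * a i = a (i + 1) * b (i + 1))
    (hcomm : ∀ i j, i ≠ j → a i * b j = b j * a i) (hw : ∀ i, w i * (1 - a i * b i) = 1)
    (hw' : ∀ i, (1 - a i * b i) * w i = 1) (h0 : ∀ x, Commute (w 0) x) (n : ℕ) :
    ((List.range n).map fun i => 1 + a i).prod * w n *
        ((List.range n).reverse.map fun i => 1 + b i).prod =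
      ((List.range n).reverse.map fun i => 1 + b i).prod *
        ((List.range n).map fun i => 1 + a i).prod * w 0 := by
  induction n with
  | zero => simp
  | succ n ih =>
    have hA : Commute ((List.range n).map fun i => 1 + a i).prod (1 + b n) := by
      refine Commute.list_prod_left _ _ fun y hy => ?_
      obtain ⟨i, hi, rfl⟩ := List.mem_map.1 hy
      exact (Commute.one_left _).add_left ((Commute.one_right _).add_right
        (hcomm i n (List.mem_range.1 hi).ne))
    have hB : Commute (1 + a n) ((List.range n).reverse.map fun i => 1 + b i).prod := by
      refine Commute.list_prod_right _ _ fun y hy => ?_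
      obtain ⟨i, hi, rfl⟩ := List.mem_map.1 hy
      exact (Commute.one_left _).add_left ((Commute.one_right _).add_right
        (hcomm n i (List.mem_range.1 (List.mem_reverse.1 hi)).ne'))
    simp only [List.range_succ, List.map_append, List.prod_append, List.reverse_append,
      List.reverse_singleton, List.map_singleton, List.prod_singleton]
    set P := ((List.range n).map fun i => 1 + a i).prod
    set Q := ((List.range n).reverse.map fun i => 1 + b i).prod
    -- Since `b n * a n = a (n + 1) * b (n + 1)`, the element `w (n + 1)` plays the part of the
    -- inverse of `1 - b n * a n`.
    have key := one_add_mul_inv_mul_one_add (hw n) (hw' n) (hba n ▸ hw (n + 1))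
      (hba n ▸ hw' (n + 1))
    calc P * (1 + a n) * w (n + 1) * ((1 + b n) * Q)
        = P * ((1 + a n) * w (n + 1) * (1 + b n)) * Q := by simp only [mul_assoc]
      _ = P * (1 + b n) * w n * ((1 + a n) * Q) := by rw [key]; simp only [mul_assoc]
      _ = (1 + b n) * (P * w n * Q) * (1 + a n) := by rw [hA.eq, hB.eq]; simp only [mul_assoc]
      _ = (1 + b n) * (Q * P) * (w 0 * (1 + a n)) := by rw [ih]; simp only [mul_assoc]
      _ = _ := by rw [(h0 _).eq]; simp only [mul_assoc]

end FiniteExchange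

/-! ### Length bounds and limits in the completion -/

section BoundedLength

variable {R : Type*} [CommRing R]

namespace PlacticCompletion

/-- Evaluation of the coefficients. -/
def evalHom (R : Type*) [CommRing R] (m : PlacticMonoid) : PlacticCompletion R →+ R where
  toFun f := f m
  map_zero' := rfl
  map_add' _ _ := rfl

theorem sum_apply {ι : Type*} (s : Finset ι) (f : ι → PlacticCompletion R) (m : PlacticMonoid) :
    (∑ i ∈ s, f i) m = ∑ i ∈ s, f i m := map_sum (evalHom R m) f s

theorem neg_apply (f : PlacticCompletion R) (m : PlacticMonoid) : (-f) m = -f m :=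
  map_neg (evalHom R m) f

/-- The series of monomials of length at most `n`. -/
def boundedLE (R : Type*) [CommRing R] (n : ℕ) : Submodule R (PlacticCompletion R) where
  carrier := {f | ∀ m, f m ≠ 0 → m ∈ lengthLE n}
  zero_mem' _ h := absurd rfl h
  add_mem' {f g} hf hg m hm := by
    by_cases h : f m = 0
    · exact hg m fun h' => hm (by rw [add_apply, h, h', add_zero])
    · exact hf m h
  smul_mem' c f hf m hm := hf m fun h => hm (by rw [smul_apply, h, mul_zero])

theorem mul_mem_boundedLE {n k : ℕ} {f g : PlacticCompletion R} (hf : f ∈ boundedLE R n)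
    (hg : g ∈ boundedLE R k) : f * g ∈ boundedLE R (n + k) :=
  mulFun_bounded hf hg

theorem single_mem_boundedLE (w : FreeMonoid Letter) {n : ℕ} (hn : w.length ≤ n) :
    (single (mk w) : PlacticCompletion R) ∈ boundedLE R n := by
  classical
  intro m hm
  rw [single_apply] at hm
  obtain rfl : m = mk w := by
    by_contra h
    exact hm (if_neg h)
  exact ⟨w, hn, rfl⟩

end PlacticCompletion

open PlacticCompletion

variable {σ : Type*}

/-- The coefficients at degree `n` are series of monomials of length at most `n`. -/
def LengthBounded (F : MvPowerSeries σ (PlacticCompletion R)) : Prop :=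
  ∀ d, MvPowerSeries.coeff d F ∈ boundedLE R d.degree

namespace LengthBounded

variable {F G : MvPowerSeries σ (PlacticCompletion R)}

theorem add (hF : LengthBounded F) (hG : LengthBounded G) : LengthBounded (F + G) := fun d => by
  rw [map_add]
  exact add_mem (hF d) (hG d)

theorem neg (hF : LengthBounded F) : LengthBounded (-F) := fun d => by
  rw [map_neg]
  exact neg_mem (hF d)

theorem mul (hF : LengthBounded F) (hG : LengthBounded G) : LengthBounded (F * G) := fun d => by
  classical
  rw [MvPowerSeries.coeff_mul]
  refine sum_mem fun p hp => ?_
  rw [Finset.HasAntidiagonal.mem_antidiagonal] at hp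
  rw [← hp, map_add]
  exact mul_mem_boundedLE (hF _) (hG _)

theorem monomial (e : σ →₀ ℕ) (c : R) (w : FreeMonoid Letter) (hw : w.length ≤ e.degree) :
    LengthBounded (MvPowerSeries.monomial e (c • single (mk w) : PlacticCompletion R)) := by
  classical
  intro d
  rw [MvPowerSeries.coeff_monomial]
  split_ifs with h
  · exact Submodule.smul_mem _ _ (single_mem_boundedLE w (h ▸ hw))
  · exact zero_mem _

theorem one : LengthBounded (1 : MvPowerSeries σ (PlacticCompletion R)) := by
  have h := monomial (R := R) (0 : σ →₀ ℕ) 1 1 (by simp)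
  rwa [one_smul, map_one, ← one_def, MvPowerSeries.monomial_zero_one] at h

theorem list_prod (l : List (MvPowerSeries σ (PlacticCompletion R)))
    (h : ∀ F ∈ l, LengthBounded F) : LengthBounded l.prod := by
  induction l with
  | nil => exact one
  | cons F l ih =>
    rw [List.prod_cons]
    exact (h F (by simp)).mul (ih fun G hG => h G (by simp [hG]))

/-- As `F` has constant term `1`, comparing coefficients at `d` in `F * G = 1` expresses that of `G`
through coefficients of `G` at smaller exponents. -/
theorem of_mul_eq_one (hF : LengthBounded F) (h0 : MvPowerSeries.constantCoeff F = 1)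
    (hFG : F * G = 1) : LengthBounded G := by
  classical
  intro d
  induction d using WellFoundedLT.induction with
  | ind d ih =>
    have h := congrArg (MvPowerSeries.coeff d) hFG
    have hmem : ((0 : σ →₀ ℕ), d) ∈ Finset.HasAntidiagonal.antidiagonal d := by
      rw [Finset.HasAntidiagonal.mem_antidiagonal, zero_add]
    rw [MvPowerSeries.coeff_mul, ← Finset.add_sum_erase _ _ hmem,
      MvPowerSeries.coeff_zero_eq_constantCoeff_apply, h0, one_mul] at h
    rw [eq_sub_of_add_eq h]
    refine sub_mem (one d) (sum_mem fun p hp => ?_)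
    rw [Finset.mem_erase, Finset.HasAntidiagonal.mem_antidiagonal] at hp
    obtain ⟨hne, hp⟩ := hp
    have hlt : p.2 < d := by
      rw [← hp]
      refine lt_add_of_pos_left _ (pos_iff_ne_zero.2 fun h => hne ?_)
      rw [Prod.ext_iff]
      exact ⟨h, by rw [← hp, h, zero_add]⟩
    have := mul_mem_boundedLE (hF p.1) (ih p.2 hlt)
    rwa [← map_add, hp] at this

end LengthBounded

/-- Equality of those coefficients on which, in products of series with `LengthBounded`, the
coefficient of `m` at exponent `D` depends. -/
def FactorAgree (D : σ →₀ ℕ) (m : PlacticMonoid)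
    (F G : MvPowerSeries σ (PlacticCompletion R)) : Prop :=
  ∀ d ≤ D, ∀ a, (∃ x y : FreeMonoid Letter,
    x.length + d.degree + y.length ≤ D.degree ∧ mk x * a * mk y = m) →
      MvPowerSeries.coeff d F a = MvPowerSeries.coeff d G a

namespace FactorAgree

variable {D : σ →₀ ℕ} {m : PlacticMonoid} {F F' G G' : MvPowerSeries σ (PlacticCompletion R)}

theorem refl (D : σ →₀ ℕ) (m : PlacticMonoid) (F : MvPowerSeries σ (PlacticCompletion R)) :
    FactorAgree D m F F := fun _ _ _ _ => rfl

theorem symm (h : FactorAgree D m F G) : FactorAgree D m G F :=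
  fun d hd a ha => (h d hd a ha).symm

theorem trans (h : FactorAgree D m F F') (h' : FactorAgree D m F' G) : FactorAgree D m F G :=
  fun d hd a ha => (h d hd a ha).trans (h' d hd a ha)

theorem add (h : FactorAgree D m F F') (h' : FactorAgree D m G G') :
    FactorAgree D m (F + G) (F' + G') := fun d hd a ha => by
  rw [map_add, map_add, PlacticCompletion.add_apply, PlacticCompletion.add_apply, h d hd a ha,
    h' d hd a ha]

theorem sub (h : FactorAgree D m F F') (h' : FactorAgree D m G G') :
    FactorAgree D m (F - G) (F' - G') := fun d hd a ha => by
  rw [map_sub, map_sub, sub_eq_add_neg, sub_eq_add_neg, PlacticCompletion.add_apply,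
    PlacticCompletion.add_apply, PlacticCompletion.neg_apply, PlacticCompletion.neg_apply,
    h d hd a ha, h' d hd a ha]

/-- If `mk x * (a₁ * a₂) * mk y = m`, a short word for `a₂` can be absorbed into `y`, and one for
`a₁` into `x`, within the same total length. So both `a₁` and `a₂` are again among the monomials
compared. Pairs with a component that is too long contribute nothing, by the length bounds. -/
theorem mul (hF' : LengthBounded F') (hG : LengthBounded G) (hG' : LengthBounded G')
    (h : FactorAgree D m F F') (h' : FactorAgree D m G G') : FactorAgree D m (F * G) (F' * G') := by
  classical
  rintro d hd a ⟨x, y, hlen, hm⟩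
  rw [MvPowerSeries.coeff_mul, MvPowerSeries.coeff_mul, PlacticCompletion.sum_apply,
    PlacticCompletion.sum_apply]
  refine Finset.sum_congr rfl fun e he => ?_
  rw [Finset.HasAntidiagonal.mem_antidiagonal] at he
  rw [mul_apply, mul_apply, mulFun, mulFun]
  refine finsum_congr fun p => ?_
  split_ifs with hp
  swap
  · rfl
  have hdeg : e.1.degree + e.2.degree = d.degree := by rw [← he, map_add]
  have h1 : p.2 ∈ lengthLE e.2.degree →
      MvPowerSeries.coeff e.1 F p.1 = MvPowerSeries.coeff e.1 F' p.1 := by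
    rintro ⟨w, hw, hwp⟩
    refine h e.1 ((he ▸ le_self_add).trans hd) p.1 ⟨x, w * y, ?_, ?_⟩
    · rw [FreeMonoid.length_mul]
      omega
    · rw [← hm, ← hp, map_mul, hwp, mul_assoc, mul_assoc, mul_assoc]
  have h2 : p.1 ∈ lengthLE e.1.degree →
      MvPowerSeries.coeff e.2 G p.2 = MvPowerSeries.coeff e.2 G' p.2 := by
    rintro ⟨w, hw, hwp⟩
    refine h' e.2 ((he ▸ le_add_self).trans hd) p.2 ⟨x * w, y, ?_, ?_⟩
    · rw [FreeMonoid.length_mul]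
      omega
    · rw [← hm, ← hp, map_mul, hwp]
      simp only [mul_assoc]
  -- `F` is replaced by `F'` first, which is allowed when `p.2` is short; otherwise `G` and `G'`
  -- both vanish at `p.2`. Then `G` is replaced by `G'` when `p.1` is short; otherwise `F'` vanishes
  -- at `p.1`.
  by_cases hp2 : p.2 ∈ lengthLE e.2.degree
  · rw [h1 hp2]
    by_cases hp1 : p.1 ∈ lengthLE e.1.degree
    · rw [h2 hp1]
    · rw [not_not.1 fun h0 => hp1 (hF' e.1 p.1 h0), zero_mul, zero_mul]
  · rw [not_not.1 fun h0 => hp2 (hG e.2 p.2 h0), not_not.1 fun h0 => hp2 (hG' e.2 p.2 h0),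
      mul_zero, mul_zero]

end FactorAgree

theorem eq_of_factorAgree {F G : MvPowerSeries σ (PlacticCompletion R)}
    (h : ∀ D m, FactorAgree D m F G) : F = G := by
  ext d : 1
  ext m
  exact h d m d le_rfl m ⟨1, 1, by simp, by simp⟩

/-- If `mk (w n)` is a factor of `m` inside a word of length at most `D.degree`, then every letter
of that word has index at most `L + D.degree`. A letter of index `n` excludes this for large `n`. -/
theorem eventually_factorAgree_monomial_zero (D : σ →₀ ℕ) (m : PlacticMonoid) (e : σ →₀ ℕ) (c : R)
    (w : ℕ → FreeMonoid Letter) (hlen : ∀ n, (w n).length ≤ e.degree)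
    (hw : ∀ n, ∃ x ∈ (w n).toList, x.index = n) :
    ∀ᶠ n in atTop, FactorAgree D m
      (MvPowerSeries.monomial e (c • single (mk (w n)) : PlacticCompletion R)) 0 := by
  classical
  obtain ⟨L, hL⟩ := exists_index_le m
  filter_upwards [eventually_gt_atTop (L + D.degree)] with n hn
  rintro d hd a ⟨x, y, hxy, hm⟩
  rw [MvPowerSeries.coeff_monomial, map_zero, PlacticCompletion.zero_apply]
  split_ifs with hde
  · rw [PlacticCompletion.smul_apply, single_apply]
    split_ifs with ha
    · exfalso
      obtain ⟨z, hz, hzn⟩ := hw n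
      have h := hL (x * w n * y) (by rw [map_mul, map_mul, ← ha, hm]) z (by simp [hz])
      have := hlen n
      rw [← hde] at this
      simp only [FreeMonoid.length_mul] at h
      omega
    · exact mul_zero c
  · rfl

theorem exists_factorAgree_limit {F : ℕ → MvPowerSeries σ (PlacticCompletion R)}
    (hF : ∀ n, LengthBounded (F n))
    (h : ∀ D m, ∀ᶠ n in atTop, FactorAgree D m (F n) (F (n + 1))) :
    ∃ G, LengthBounded G ∧ ∀ D m, ∀ᶠ n in atTop, FactorAgree D m G (F n) := by
  have h' : ∀ D m, ∃ k, ∀ n, k ≤ n → FactorAgree D m (F k) (F n) := fun D m => by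
    obtain ⟨k, hk⟩ := eventually_atTop.1 (h D m)
    refine ⟨k, fun n hn => ?_⟩
    induction n, hn using Nat.le_induction with
    | base => exact FactorAgree.refl _ _ _
    | succ n hn ih => exact ih.trans (hk n hn)
  choose k hk using h'
  have hbd : ∀ D m, MvPowerSeries.coeff D (F (k D m)) m ≠ 0 → m ∈ lengthLE D.degree :=
    fun D m hm => hF _ D m hm
  refine ⟨fun D => ⟨fun m => MvPowerSeries.coeff D (F (k D m)) m, D.degree, hbd D⟩, hbd,
    fun D m => ?_⟩
  filter_upwards [eventually_ge_atTop (k D m)] with n hn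
  rintro d hd a ha
  change MvPowerSeries.coeff d (F (k d a)) a = _
  -- The limit is read off at stage `k d a`, which may come before or after `k D m`; a common later
  -- stage compares the two.
  have h1 := hk d a (max (k d a) (k D m)) (le_max_left _ _) d le_rfl a ⟨1, 1, by simp, by simp⟩
  have h2 := hk D m (max (k d a) (k D m)) (le_max_right _ _) d hd a ha
  have h3 := hk D m n hn d hd a ha
  rw [h1, ← h2, h3]

end BoundedLength

end PlacticCauchy

namespace PlacticCauchy

open Filter Topology PlacticMonoid PlacticCompletion

/-! ### The infinite products in one variable and their exchange -/

section CompletedFactors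

variable {R : Type*} [CommRing R] {σ : Type*}

/-- The elements `p • [L i]` of the completion. -/
noncomputable def letterSeq (L : ℕ → Letter) (p : R) (i : ℕ) : PlacticCompletion R :=
  p • single (mk (.of (L i)))

theorem linTerm_letterSeq (L : ℕ → Letter) (p : R) (x : σ) (i : ℕ) :
    linTerm (letterSeq L p) x i =
      MvPowerSeries.monomial (Finsupp.single x 1) (p • single (mk (.of (L i)))) := rfl

/-- Sign changes are absorbed into the scalar, so the products `∏ (1 + p [L i] x)` serve both
degrees. -/
theorem one_sub_linTerm_letterSeq (L : ℕ → Letter) (p : R) (x : σ) (i : ℕ) :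
    1 - linTerm (letterSeq L p) x i = 1 + linTerm (letterSeq L (-p)) x i := by
  rw [linTerm_letterSeq, linTerm_letterSeq, neg_smul, map_neg, sub_eq_add_neg]

theorem lengthBounded_linTerm (L : ℕ → Letter) (p : R) (x : σ) (i : ℕ) :
    LengthBounded (linTerm (letterSeq L p) x i) :=
  LengthBounded.monomial _ _ _ (by simp)

theorem lengthBounded_prod_one_add_linTerm (L : ℕ → Letter) (p : R) (x : σ) (l : List ℕ) :
    LengthBounded (l.map fun i => 1 + linTerm (letterSeq L p) x i).prod :=
  LengthBounded.list_prod _ fun F hF => by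
    obtain ⟨i, -, rfl⟩ := List.mem_map.1 hF
    exact LengthBounded.one.add (lengthBounded_linTerm L p x i)

theorem eventually_one_add_linTerm_factorAgree {L : ℕ → Letter} (hL : ∀ i, (L i).index = i)
    (p : R) (x : σ) (D : σ →₀ ℕ) (m : PlacticMonoid) :
    ∀ᶠ n in atTop, FactorAgree D m 1 (1 + linTerm (letterSeq L p) x n) := by
  have := eventually_factorAgree_monomial_zero D m (Finsupp.single x 1) p
    (fun n => .of (L n)) (by simp) (fun n => ⟨L n, by simp, hL n⟩)
  filter_upwards [this] with n hn
  rw [linTerm_letterSeq]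
  have h := ((FactorAgree.refl D m 1).add hn).symm
  rwa [add_zero] at h

theorem exists_increasing_limit {L : ℕ → Letter} (hL : ∀ i, (L i).index = i) (p : R) (x : σ) :
    ∃ G, LengthBounded G ∧ ∀ D m, ∀ᶠ n in atTop, FactorAgree D m G
      ((List.range n).map fun i => 1 + linTerm (letterSeq L p) x i).prod := by
  refine exists_factorAgree_limit (fun n => lengthBounded_prod_one_add_linTerm L p x _)
    fun D m => ?_
  filter_upwards [eventually_one_add_linTerm_factorAgree hL p x D m] with n hn
  rw [List.range_succ, List.map_append, List.prod_append, List.map_singleton, List.prod_singleton]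
  have hP := lengthBounded_prod_one_add_linTerm L p x (List.range n)
  simpa using (FactorAgree.refl D m _).mul hP LengthBounded.one
    (LengthBounded.one.add (lengthBounded_linTerm L p x n)) hn

theorem exists_decreasing_limit {L : ℕ → Letter} (hL : ∀ i, (L i).index = i) (p : R) (x : σ) :
    ∃ G, LengthBounded G ∧ ∀ D m, ∀ᶠ n in atTop, FactorAgree D m G
      ((List.range n).reverse.map fun i => 1 + linTerm (letterSeq L p) x i).prod := by
  refine exists_factorAgree_limit (fun n => lengthBounded_prod_one_add_linTerm L p x _)
    fun D m => ?_
  filter_upwards [eventually_one_add_linTerm_factorAgree hL p x D m] with n hn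
  rw [List.range_succ, List.reverse_append, List.map_append, List.prod_append,
    List.reverse_singleton, List.map_singleton, List.prod_singleton]
  have hP := lengthBounded_prod_one_add_linTerm L p x (List.range n).reverse
  simpa using hn.mul
    (LengthBounded.one.add (lengthBounded_linTerm L p x n)) hP hP (FactorAgree.refl D m _)

/-- The infinite product `(1 + p [u 0] x) (1 + p [u 1] x) ⋯`. -/
noncomputable def uProd (p : R) (x : σ) : MvPowerSeries σ (PlacticCompletion R) :=
  (exists_increasing_limit (L := .pos) (fun _ => rfl) p x).choose

/-- The infinite product `⋯ (1 + p [v 1] x) (1 + p [v 0] x)`. -/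
noncomputable def vProd (p : R) (x : σ) : MvPowerSeries σ (PlacticCompletion R) :=
  (exists_decreasing_limit (L := .dual) (fun _ => rfl) p x).choose

theorem lengthBounded_uProd (p : R) (x : σ) : LengthBounded (uProd p x) :=
  (exists_increasing_limit (L := .pos) (fun _ => rfl) p x).choose_spec.1

theorem lengthBounded_vProd (p : R) (x : σ) : LengthBounded (vProd p x) :=
  (exists_decreasing_limit (L := .dual) (fun _ => rfl) p x).choose_spec.1

theorem eventually_uProd_factorAgree (p : R) (x : σ) (D : σ →₀ ℕ) (m : PlacticMonoid) :
    ∀ᶠ n in atTop, FactorAgree D m (uProd p x)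
      ((List.range n).map fun i => 1 + linTerm (letterSeq .pos p) x i).prod :=
  (exists_increasing_limit (L := .pos) (fun _ => rfl) p x).choose_spec.2 D m

theorem eventually_vProd_factorAgree (p : R) (x : σ) (D : σ →₀ ℕ) (m : PlacticMonoid) :
    ∀ᶠ n in atTop, FactorAgree D m (vProd p x)
      ((List.range n).reverse.map fun i => 1 + linTerm (letterSeq .dual p) x i).prod :=
  (exists_decreasing_limit (L := .dual) (fun _ => rfl) p x).choose_spec.2 D m

theorem prod_one_add_linTerm_agreeUpTo_one (L : ℕ → Letter) (p : R) {x : σ} {d : σ →₀ ℕ}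
    (hd : d x = 0) (l : List ℕ) :
    AgreeUpTo d (l.map fun i => 1 + linTerm (letterSeq L p) x i).prod 1 := by
  refine AgreeUpTo.list_prod_one _ fun F hF => ?_
  obtain ⟨i, -, rfl⟩ := List.mem_map.1 hF
  have := (AgreeUpTo.refl d 1).add
    (AgreeUpTo.monomial_zero (d := d) (e := Finsupp.single x 1) (fun h => ?_)
      (letterSeq L p i))
  · rwa [add_zero] at this
  · have := h x
    rw [Finsupp.single_eq_same, hd] at this
    omega

theorem agreeUpTo_of_eventually_factorAgree {F : ℕ → MvPowerSeries σ (PlacticCompletion R)}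
    {G H : MvPowerSeries σ (PlacticCompletion R)} {d : σ →₀ ℕ}
    (h : ∀ D m, ∀ᶠ n in atTop, FactorAgree D m G (F n)) (hF : ∀ n, AgreeUpTo d (F n) H) :
    AgreeUpTo d G H := by
  intro e he
  ext m
  obtain ⟨n, hn⟩ := (h e m).exists
  rw [hn e le_rfl m ⟨1, 1, by simp, by simp⟩, hF n e he]

theorem uProd_agreeUpTo_one (p : R) {x : σ} {d : σ →₀ ℕ} (hd : d x = 0) :
    AgreeUpTo d (uProd p x) 1 :=
  agreeUpTo_of_eventually_factorAgree (eventually_uProd_factorAgree p x)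
    fun _ => prod_one_add_linTerm_agreeUpTo_one _ p hd _

theorem vProd_agreeUpTo_one (p : R) {x : σ} {d : σ →₀ ℕ} (hd : d x = 0) :
    AgreeUpTo d (vProd p x) 1 :=
  agreeUpTo_of_eventually_factorAgree (eventually_vProd_factorAgree p x)
    fun _ => prod_one_add_linTerm_agreeUpTo_one _ p hd _

theorem exists_inverse {E : Type*} [Ring E] {F : MvPowerSeries σ E}
    (hF : MvPowerSeries.constantCoeff F = 1) : ∃ G, F * G = 1 ∧ G * F = 1 := by
  have h : IsUnit F := MvPowerSeries.isUnit_iff_constantCoeff.2 (hF ▸ isUnit_one)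
  exact ⟨_, h.mul_val_inv, h.val_inv_mul⟩

theorem constantCoeff_eq_one {E : Type*} [Ring E] {F : MvPowerSeries σ E}
    (hF : AgreeUpTo 0 F 1) : MvPowerSeries.constantCoeff F = 1 := by
  simpa using hF 0 le_rfl

theorem linTerm_mul_linTerm (L L' : ℕ → Letter) (p q : R) (x y : σ) (i j : ℕ) :
    linTerm (letterSeq L p) x i * linTerm (letterSeq L' q) y j =
      MvPowerSeries.monomial (Finsupp.single x 1 + Finsupp.single y 1)
        ((p * q) • single (mk (.of (L i) * .of (L' j)))) := by
  rw [linTerm_letterSeq, linTerm_letterSeq, MvPowerSeries.monomial_mul_monomial, smul_mul_smul_comm,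
    single_mul_single, map_mul]

/-- Scalar power series, with central image. -/
noncomputable def scalarMap (E : Type*) [Ring E] [Algebra R E] :
    MvPowerSeries σ R →+* MvPowerSeries σ E :=
  MvPowerSeries.map (algebraMap R E)

theorem scalarMap_commute {E : Type*} [Ring E] [Algebra R E] (c : MvPowerSeries σ R)
    (F : MvPowerSeries σ E) : Commute (scalarMap E c) F := by
  classical
  ext d
  rw [MvPowerSeries.coeff_mul, MvPowerSeries.coeff_mul, Finsupp.sum_antidiagonal_swap d fun a b =>
    MvPowerSeries.coeff a F * MvPowerSeries.coeff b (scalarMap E c)]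
  refine Finset.sum_congr rfl fun p _ => ?_
  rw [scalarMap, MvPowerSeries.coeff_map]
  exact Algebra.commutes _ _

/-- The series `c x y` with `c` a scalar. -/
noncomputable def scalarTerm (c : R) (x y : σ) : MvPowerSeries σ R :=
  MvPowerSeries.C c * MvPowerSeries.X x * MvPowerSeries.X y

theorem scalarMap_scalarTerm (E : Type*) [Ring E] [Algebra R E] (c : R) (x y : σ) :
    scalarMap E (scalarTerm c x y) = MvPowerSeries.monomial
      (Finsupp.single x 1 + Finsupp.single y 1) (c • (1 : E)) := by
  rw [scalarMap, scalarTerm, MvPowerSeries.X, MvPowerSeries.X, mul_assoc,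
    MvPowerSeries.monomial_mul_monomial, ← MvPowerSeries.monomial_zero_eq_C_apply,
    MvPowerSeries.monomial_mul_monomial, MvPowerSeries.map_monomial]
  simp [Algebra.algebraMap_eq_smul_one]

/-- This is the limit of `prod_exchange`: the series `w n` in the middle tends to `1` because `a n *
b n` consists of letters of index `n`, while `w 0` is the inverse of the scalar series `1 - p q x
y`. -/
theorem uProd_mul_vProd (p q : R) (x y : σ) :
    uProd p x * vProd q y * (1 - scalarMap _ (scalarTerm (p * q) x y)) =
      vProd q y * uProd p x := by
  set a : ℕ → MvPowerSeries σ (PlacticCompletion R) := linTerm (letterSeq .pos p) x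
  set b : ℕ → MvPowerSeries σ (PlacticCompletion R) := linTerm (letterSeq .dual q) y
  have hab : ∀ i j, a i * b j = MvPowerSeries.monomial (Finsupp.single x 1 + Finsupp.single y 1)
      ((p * q) • single (mk (.of (.pos i) * .of (.dual j)))) :=
    linTerm_mul_linTerm _ _ p q x y
  have hba : ∀ i j, b i * a j = MvPowerSeries.monomial (Finsupp.single x 1 + Finsupp.single y 1)
      ((p * q) • single (mk (.of (.dual i) * .of (.pos j)))) := fun i j => by
    rw [linTerm_mul_linTerm, add_comm, mul_comm q]
  -- In the monoid `u 0 * v 0 = 1`, so this product is a scalar series.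
  have h00 : a 0 * b 0 = scalarMap _ (scalarTerm (p * q) x y) := by
    rw [hab, scalarMap_scalarTerm, one_def, ← map_one PlacticMonoid.mk]
    exact congrArg (fun m => MvPowerSeries.monomial _ ((p * q) • single m))
      (PresentedMonoid.mk_eq_mk_of_rel PlacticRel.contract)
  have hunit : ∀ i, MvPowerSeries.constantCoeff (1 - a i * b i) = 1 := fun i => by
    classical
    rw [hab, map_sub, map_one, ← MvPowerSeries.coeff_zero_eq_constantCoeff_apply,
      MvPowerSeries.coeff_monomial, if_neg, sub_zero]
    intro h
    have := DFunLike.congr_fun h x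
    rw [Finsupp.add_apply, Finsupp.single_eq_same, Finsupp.zero_apply] at this
    omega
  choose w hw hw' using fun i => exists_inverse (hunit i)
  have hw0 : ∀ F, Commute (w 0) F := fun F => by
    have h : Commute (1 - a 0 * b 0) F := by
      rw [h00]
      exact (Commute.one_left F).sub_left (scalarMap_commute _ F)
    calc w 0 * F = w 0 * (F * ((1 - a 0 * b 0) * w 0)) := by rw [hw, mul_one]
      _ = w 0 * ((1 - a 0 * b 0) * F) * w 0 := by rw [h.eq]; simp only [mul_assoc]
      _ = F * w 0 := by rw [← mul_assoc (w 0), hw', one_mul]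
  have key := prod_exchange a b w
    (fun i => by
      rw [hab, hba]
      exact congrArg (fun m => MvPowerSeries.monomial _ ((p * q) • single m))
        (PresentedMonoid.mk_eq_mk_of_rel (PlacticRel.shift i)).symm)
    (fun i j hij => by
      rw [hab, hba]
      exact congrArg (fun m => MvPowerSeries.monomial _ ((p * q) • single m))
        (PresentedMonoid.mk_eq_mk_of_rel (PlacticRel.comm hij))) hw' hw hw0
  have hbd : ∀ i, LengthBounded (1 - a i * b i) := fun i => by
    rw [sub_eq_add_neg]
    exact LengthBounded.one.add
      ((lengthBounded_linTerm _ p x i).mul (lengthBounded_linTerm _ q y i)).neg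
  have hwbd : ∀ i, LengthBounded (w i) := fun i => (hbd i).of_mul_eq_one (hunit i) (hw i)
  have hU := lengthBounded_uProd p x
  have hV := lengthBounded_vProd q y
  have hlim : uProd p x * vProd q y = vProd q y * uProd p x * w 0 := by
    refine eq_of_factorAgree fun D m => ?_
    have hsmall := eventually_factorAgree_monomial_zero D m
      (Finsupp.single x 1 + Finsupp.single y 1) (p * q)
      (fun n => .of (.pos n) * .of (.dual n)) (by simp [FreeMonoid.length_mul])
      (fun n => ⟨.pos n, by simp, rfl⟩)
    obtain ⟨n, ⟨h1, h2⟩, h3⟩ := ((eventually_uProd_factorAgree p x D m).and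
      (eventually_vProd_factorAgree q y D m)).and hsmall |>.exists
    rw [← hab] at h3
    have hUn := lengthBounded_prod_one_add_linTerm .pos p x (List.range n)
    have hVn := lengthBounded_prod_one_add_linTerm .dual q y (List.range n).reverse
    -- Multiply the agreement of `1 - a n * b n` with `1` by `w n`.
    have hwn : FactorAgree D m 1 (w n) := by
      have := ((FactorAgree.refl D m 1).sub h3).mul (by simpa using LengthBounded.one)
        (hwbd n) (hwbd n) (FactorAgree.refl D m (w n))
      rwa [hw, sub_zero, one_mul] at this
    have hl := (h1.mul hUn LengthBounded.one (hwbd n) hwn).mul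
      (hUn.mul (hwbd n)) hV hVn h2
    have hr := (h2.mul hVn hU hUn h1).mul (hVn.mul hUn) (hwbd 0) (hwbd 0)
      (FactorAgree.refl D m (w 0))
    rw [mul_one, key n] at hl
    exact hl.trans hr.symm
  rw [hlim, ← h00, mul_assoc, hw', mul_one]

end CompletedFactors

end PlacticCauchy

namespace PlacticCauchy

open Filter Topology PlacticMonoid PlacticCompletion

/-! ### Exchange relations for inverses -/

section InverseExchange

variable {M : Type*} [Monoid M] {U U' V V' z : M}

/-- Inverting one of `U`, `V` moves the central `z` to the other side of the relation, and inverting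
both moves it back. Thus unequal degrees contribute to the numerator of the Cauchy kernel and equal
degrees to its denominator. -/
theorem inv_mul_of_exchange (h : U * V * z = V * U) (hz : ∀ x, Commute z x) (hU : U * U' = 1)
    (hU' : U' * U = 1) : U' * V = V * U' * z := by
  calc U' * V = U' * (V * U) * U' := by simp only [mul_assoc, hU, mul_one]
    _ = (U' * U) * V * (z * U') := by rw [← h]; simp only [mul_assoc]
    _ = V * U' * z := by rw [hU', one_mul, (hz U').eq, mul_assoc]

theorem mul_inv_of_exchange (h : U * V * z = V * U) (hz : ∀ x, Commute z x) (hV : V * V' = 1)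
    (hV' : V' * V = 1) : U * V' = V' * U * z := by
  calc U * V' = V' * (V * U) * V' := by rw [← mul_assoc V', hV', one_mul]
    _ = V' * U * V * (z * V') := by rw [← h]; simp only [mul_assoc]
    _ = V' * U * (V * V') * z := by rw [(hz V').eq]; simp only [mul_assoc]
    _ = V' * U * z := by rw [hV, mul_one]

theorem inv_mul_inv_of_exchange (h : U * V * z = V * U) (hz : ∀ x, Commute z x) (hU : U * U' = 1)
    (hU' : U' * U = 1) (hV : V * V' = 1) (hV' : V' * V = 1) : U' * V' * z = V' * U' := by
  have h₁ := inv_mul_of_exchange h hz hU hU'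
  calc U' * V' * z = V' * (V * U' * z) * V' := by
        rw [mul_assoc V U', ← mul_assoc V', hV', one_mul, mul_assoc U', ← (hz V').eq, mul_assoc U']
    _ = V' * U' := by rw [← h₁, mul_assoc, mul_assoc, hV, mul_one]

end InverseExchange

/-! ### The factors for both degrees and their images under homomorphisms -/

section Factors

variable {R : Type*} [CommRing R] {σ : Type*}

/-- The series `𝒬(x)` with `u i = t • [u i]`, for a variable of degree `ε`. -/
noncomputable def uFactor (t : R) (ε : ZMod 2) (x : σ) : MvPowerSeries σ (PlacticCompletion R) :=
  if ε = 0 then MvPowerSeries.invOfUnit (uProd (-t) x) 1 else uProd t x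

/-- The series `𝒫(x)`, for a variable of degree `ε`. -/
noncomputable def vFactor (R : Type*) [CommRing R] (ε : ZMod 2) (x : σ) :
    MvPowerSeries σ (PlacticCompletion R) :=
  if ε = 0 then MvPowerSeries.invOfUnit (vProd (-1) x) 1 else vProd 1 x

theorem uProd_mul_invOfUnit (p : R) (x : σ) :
    uProd p x * MvPowerSeries.invOfUnit (uProd p x) 1 = 1 :=
  MvPowerSeries.mul_invOfUnit _ _ (constantCoeff_eq_one (uProd_agreeUpTo_one p rfl))

theorem invOfUnit_mul_uProd (p : R) (x : σ) :
    MvPowerSeries.invOfUnit (uProd p x) 1 * uProd p x = 1 :=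
  MvPowerSeries.invOfUnit_mul _ _ (constantCoeff_eq_one (uProd_agreeUpTo_one p rfl))

theorem vProd_mul_invOfUnit (p : R) (x : σ) :
    vProd p x * MvPowerSeries.invOfUnit (vProd p x) 1 = 1 :=
  MvPowerSeries.mul_invOfUnit _ _ (constantCoeff_eq_one (vProd_agreeUpTo_one p rfl))

theorem invOfUnit_mul_vProd (p : R) (x : σ) :
    MvPowerSeries.invOfUnit (vProd p x) 1 * vProd p x = 1 :=
  MvPowerSeries.invOfUnit_mul _ _ (constantCoeff_eq_one (vProd_agreeUpTo_one p rfl))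

theorem uFactor_agreeUpTo_one (t : R) (ε : ZMod 2) {x : σ} {d : σ →₀ ℕ} (hd : d x = 0) :
    AgreeUpTo d (uFactor t ε x) 1 := by
  rw [uFactor]
  split_ifs
  · exact (uProd_agreeUpTo_one (-t) hd).one_of_mul_eq_one (invOfUnit_mul_uProd _ _)
  · exact uProd_agreeUpTo_one t hd

theorem vFactor_agreeUpTo_one (ε : ZMod 2) {x : σ} {d : σ →₀ ℕ} (hd : d x = 0) :
    AgreeUpTo d (vFactor R ε x) 1 := by
  rw [vFactor]
  split_ifs
  · exact (vProd_agreeUpTo_one (-1) hd).one_of_mul_eq_one (invOfUnit_mul_vProd _ _)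
  · exact vProd_agreeUpTo_one 1 hd

theorem scalarTerm_neg (c : R) (x y : σ) : scalarTerm (-c) x y = -scalarTerm c x y := by
  rw [scalarTerm, scalarTerm, map_neg, neg_mul, neg_mul]

/-- The contribution of `x`, `y` to the denominator of the Cauchy kernel. -/
noncomputable def kernelDen (t : R) (ε δ : ZMod 2) (x y : σ) : MvPowerSeries σ R :=
  if ε = δ then 1 - scalarTerm t x y else 1

/-- The contribution of `x`, `y` to the numerator of the Cauchy kernel. -/
noncomputable def kernelNum (t : R) (ε δ : ZMod 2) (x y : σ) : MvPowerSeries σ R :=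
  if ε ≠ δ then 1 + scalarTerm t x y else 1

/-- The scalar is `p = -t` or `t` and `q = -1` or `1` for degree `0` or `1`. Hence `p * q` is `t`
for equal degrees and `-t` for unequal ones, where exactly one of the two products is inverted. -/
theorem uFactor_mul_vFactor (t : R) (ε δ : ZMod 2) (x y : σ) :
    uFactor t ε x * vFactor R δ y * scalarMap _ (kernelDen t ε δ x y) =
      vFactor R δ y * uFactor t ε x * scalarMap _ (kernelNum t ε δ x y) := by
  have hex : ∀ p q : R, uProd p x * vProd q y * scalarMap _ (1 - scalarTerm (p * q) x y) =
      vProd q y * uProd p x := fun p q => by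
    rw [map_sub, map_one, uProd_mul_vProd]
  have hz : ∀ (c : MvPowerSeries σ R) (F : MvPowerSeries σ (PlacticCompletion R)),
      Commute (scalarMap _ c) F := scalarMap_commute
  rw [uFactor, vFactor, kernelDen, kernelNum]
  by_cases hε : ε = 0 <;> by_cases hδ : δ = 0
  · have h := inv_mul_inv_of_exchange (hex (-t) (-1)) (hz _) (uProd_mul_invOfUnit _ _)
      (invOfUnit_mul_uProd _ _) (vProd_mul_invOfUnit _ _) (invOfUnit_mul_vProd _ _)
    rw [neg_mul_neg, mul_one] at h
    have hεδ : ε = δ := hε.trans hδ.symm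
    rw [if_pos hε, if_pos hδ, if_pos hεδ, if_neg (not_not.2 hεδ), h, map_one, mul_one]
  · have h := inv_mul_of_exchange (hex (-t) 1) (hz _) (uProd_mul_invOfUnit _ _)
      (invOfUnit_mul_uProd _ _)
    rw [mul_one, scalarTerm_neg, sub_neg_eq_add] at h
    rw [if_pos hε, if_neg hδ, if_neg (by rw [hε]; exact Ne.symm hδ),
      if_pos (by rw [hε]; exact Ne.symm hδ), h, map_one, mul_one]
  · have h := mul_inv_of_exchange (hex t (-1)) (hz _) (vProd_mul_invOfUnit _ _)
      (invOfUnit_mul_vProd _ _)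
    rw [mul_neg_one, scalarTerm_neg, sub_neg_eq_add] at h
    rw [if_neg hε, if_pos hδ, if_neg (by rwa [hδ]), if_pos (by rwa [hδ]), h, map_one, mul_one]
  · have hεδ : ε = δ := by
      revert hε hδ
      revert ε δ
      decide
    have h := hex t 1
    rw [mul_one] at h
    rw [if_neg hε, if_neg hδ, if_pos hεδ, if_neg (not_not.2 hεδ), h, map_one, mul_one]

theorem map_linTerm {E : Type*} [Ring E] (φ : PlacticCompletion R →+* E)
    (u : ℕ → PlacticCompletion R) (x : σ) (i : ℕ) :
    MvPowerSeries.map φ (linTerm u x i) = linTerm (fun i => φ (u i)) x i := by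
  rw [linTerm, MvPowerSeries.map_monomial, linTerm]

theorem map_list_prod_one_add_linTerm {E : Type*} [Ring E] (φ : PlacticCompletion R →+* E)
    (u : ℕ → PlacticCompletion R) (x : σ) (l : List ℕ) :
    MvPowerSeries.map φ (l.map fun i => 1 + linTerm u x i).prod =
      (l.map fun i => 1 + linTerm (fun i => φ (u i)) x i).prod := by
  rw [map_list_prod, List.map_map]
  congr 2
  funext i
  rw [Function.comp_apply, map_add, map_one, map_linTerm]

theorem map_list_prod_one_add_linTerm_neg {E : Type*} [Ring E] (φ : PlacticCompletion R →+* E)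
    (L : ℕ → Letter) (t : R) (x : σ) (l : List ℕ) :
    MvPowerSeries.map φ (l.map fun i => 1 + linTerm (letterSeq L (-t)) x i).prod =
      (l.map fun i => 1 - linTerm (fun i => φ (letterSeq L t i)) x i).prod := by
  rw [map_list_prod, List.map_map]
  congr 2
  funext i
  rw [Function.comp_apply, ← one_sub_linTerm_letterSeq, map_sub, map_one, map_linTerm]

/-- Compatibility of a ring homomorphism with coefficientwise limits of series of monomials of
bounded length. -/
def BoundedContinuous {E : Type*} [Ring E] [TopologicalSpace E]
    (φ : PlacticCompletion R →+* E) : Prop :=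
  ∀ (n : ℕ) (f : ℕ → PlacticCompletion R) (g : PlacticCompletion R),
    (∀ k, f k ∈ boundedLE R n) → g ∈ boundedLE R n → (∀ m, ∀ᶠ k in atTop, f k m = g m) →
      Tendsto (fun k => φ (f k)) atTop (𝓝 (φ g))

theorem BoundedContinuous.id : BoundedContinuous (RingHom.id (PlacticCompletion R)) := by
  intro n f g _ _ h
  let _ : TopologicalSpace R := ⊥
  have hind : Topology.IsInducing (fun f : PlacticCompletion R => (f : PlacticMonoid → R)) := ⟨rfl⟩
  rw [hind.tendsto_nhds_iff, tendsto_pi_nhds]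
  intro m
  refine tendsto_const_nhds.congr' ?_
  filter_upwards [h m] with k hk
  exact hk.symm

variable {E : Type*} [Ring E] [TopologicalSpace E] {φ : PlacticCompletion R →+* E}

theorem BoundedContinuous.tendsto_map (hφ : BoundedContinuous φ)
    {F : ℕ → MvPowerSeries σ (PlacticCompletion R)} {G : MvPowerSeries σ (PlacticCompletion R)}
    (hF : ∀ n, LengthBounded (F n)) (hG : LengthBounded G)
    (h : ∀ D m, ∀ᶠ n in atTop, FactorAgree D m G (F n)) :
    Tendsto (fun n => MvPowerSeries.map φ (F n)) atTop (𝓝 (MvPowerSeries.map φ G)) := by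
  rw [MvPowerSeries.WithPiTopology.tendsto_iff_coeff_tendsto]
  intro d
  simp only [MvPowerSeries.coeff_map]
  refine hφ d.degree _ _ (fun k => hF k d) (hG d) fun m => ?_
  filter_upwards [h d m] with n hn
  exact (hn d le_rfl m ⟨1, 1, by simp, by simp⟩).symm

theorem BoundedContinuous.isQFactor (hφ : BoundedContinuous φ) (t : R) (x : σ) (ε : ZMod 2) :
    IsQFactor (fun i => φ (letterSeq .pos t i)) x ε (MvPowerSeries.map φ (uFactor t ε x)) := by
  rw [IsQFactor, uFactor]
  have h := fun p : R => hφ.tendsto_map (fun n => lengthBounded_prod_one_add_linTerm .pos p x _)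
    (lengthBounded_uProd p x) (eventually_uProd_factorAgree p x)
  split_ifs
  · refine ⟨MvPowerSeries.map φ (uProd (-t) x), ?_, ?_, ?_⟩
    · simpa only [map_list_prod_one_add_linTerm_neg] using h (-t)
    · rw [← map_mul, invOfUnit_mul_uProd, map_one]
    · rw [← map_mul, uProd_mul_invOfUnit, map_one]
  · simpa only [map_list_prod_one_add_linTerm] using h t

theorem BoundedContinuous.isPFactor (hφ : BoundedContinuous φ) (x : σ) (ε : ZMod 2) :
    IsPFactor (fun i => φ (letterSeq .dual 1 i)) x ε (MvPowerSeries.map φ (vFactor R ε x)) := by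
  rw [IsPFactor, vFactor]
  have h := fun p : R => hφ.tendsto_map (fun n => lengthBounded_prod_one_add_linTerm .dual p x _)
    (lengthBounded_vProd p x) (eventually_vProd_factorAgree p x)
  split_ifs
  · refine ⟨MvPowerSeries.map φ (vProd (-1) x), ?_, ?_, ?_⟩
    · simpa only [map_list_prod_one_add_linTerm_neg] using h (-1)
    · rw [← map_mul, invOfUnit_mul_vProd, map_one]
    · rw [← map_mul, vProd_mul_invOfUnit, map_one]
  · simpa only [map_list_prod_one_add_linTerm] using h 1

end Factors

/-! ### The Cauchy identity in the completed algebra -/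

section CauchyIdentity

variable {R : Type*} [CommRing R] {A B : Type*}

theorem scalarTerm_agreeUpTo_zero (t : R) {a : A} {b : B} {d : A ⊕ B →₀ ℕ}
    (hd : ¬ (d (.inl a) ≠ 0 ∧ d (.inr b) ≠ 0)) :
    AgreeUpTo d (scalarTerm t (.inl a) (.inr b)) 0 := by
  have hX : ∀ i, d i = 0 → AgreeUpTo d (MvPowerSeries.X i : MvPowerSeries (A ⊕ B) R) 0 :=
    fun i hi => AgreeUpTo.monomial_zero (fun h => by
      have := h i
      rw [Finsupp.single_eq_same, hi] at this
      omega) 1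
  rw [not_and_or, not_not, not_not] at hd
  rw [scalarTerm]
  rcases hd with h | h
  · have := ((AgreeUpTo.refl d (MvPowerSeries.C t)).mul (hX _ h)).mul
      (AgreeUpTo.refl d (MvPowerSeries.X (.inr b)))
    rwa [mul_zero, zero_mul] at this
  · have := (AgreeUpTo.refl d (MvPowerSeries.C t * MvPowerSeries.X (.inl a))).mul (hX _ h)
    rwa [mul_zero] at this

theorem finite_setOf_exponent_ne_zero {σ : Type*} {i : A → σ} (hi : Function.Injective i)
    (d : σ →₀ ℕ) : {a | d (i a) ≠ 0}.Finite :=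
  (d.hasFiniteSupport.preimage hi.injOn).subset fun _ h => h

theorem locallyFiniteFactors_of_exponent {E : Type*} [Ring E] {σ : Type*} {i : A → σ}
    (hi : Function.Injective i) {f : A → MvPowerSeries σ E}
    (hf : ∀ d a, d (i a) = 0 → AgreeUpTo d (f a) 1) : LocallyFiniteFactors f := fun d =>
  (finite_setOf_exponent_ne_zero hi d).subset fun a ha h => ha (hf d a h)

theorem locallyFiniteFactors_of_pair {p : A × B → Prop}
    {f : {c : A × B // p c} → MvPowerSeries (A ⊕ B) R}
    (hf : ∀ d c, ¬ (d (.inl c.1.1) ≠ 0 ∧ d (.inr c.1.2) ≠ 0) → AgreeUpTo d (f c) 1) :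
    LocallyFiniteFactors f := fun d => by
  have h := ((finite_setOf_exponent_ne_zero (Sum.inl_injective (α := A) (β := B)) d).prod
    (finite_setOf_exponent_ne_zero (Sum.inr_injective (α := A) (β := B)) d)).preimage
    (f := (Subtype.val : {c : A × B // p c} → A × B)) Subtype.val_injective.injOn
  exact h.subset fun c hc => by
    by_contra h'
    exact hc (hf d c h')

/-- Rectangles are cofinal among finite sets of pairs. So the unconditional products over pairs can
be evaluated on the same finite sets as the ordered products over `A` and `B`. -/
theorem tendsto_subtype_product (p : A × B → Prop) [DecidablePred p] :
    Tendsto (fun s : Finset A × Finset B => (s.1 ×ˢ s.2).subtype p) atTop atTop := by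
  classical
  refine tendsto_atTop.2 fun S => ?_
  filter_upwards [eventually_ge_atTop (S.image fun c => c.1.1, S.image fun c => c.1.2)] with s hs
  intro c hc
  rw [Finset.mem_subtype, Finset.mem_product]
  exact ⟨hs.1 (Finset.mem_image_of_mem (fun c : {c // p c} => c.1.1) hc),
    hs.2 (Finset.mem_image_of_mem (fun c : {c // p c} => c.1.2) hc)⟩

theorem list_prod_sort [LinearOrder A] {M : Type*} [CommMonoid M] (f : A → M) (s : Finset A) :
    ((s.sort (· ≤ ·)).map f).prod = ∏ a ∈ s, f a := by
  rw [← Finset.prod_map_toList]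
  exact ((Finset.sort_perm_toList s (· ≤ ·)).map f).prod_eq

theorem prod_subtype_product [LinearOrder A] [LinearOrder B] {M : Type*} [CommMonoid M]
    (p : A × B → Prop) [DecidablePred p] (F : A → B → M) (s : Finset A) (s' : Finset B) :
    ∏ c ∈ (s ×ˢ s').subtype p, F c.1.1 c.1.2 = ((s.sort (· ≤ ·)).map fun a =>
      ((s'.sort (· ≤ ·)).map fun b => if p (a, b) then F a b else 1).prod).prod := by
  simp only [list_prod_sort]
  rw [Finset.prod_subtype_eq_prod_filter (s := s ×ˢ s') (p := p) (fun c : A × B => F c.1 c.2),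
    Finset.prod_filter, Finset.prod_product]

theorem list_prod_uFactor_mul_list_prod_vFactor (t : R) (dA : A → ZMod 2) (dB : B → ZMod 2)
    (k : List A) (l : List B) :
    (k.map fun a => uFactor t (dA a) (Sum.inl a : A ⊕ B)).prod *
        (l.map fun b => vFactor R (dB b) (Sum.inr b : A ⊕ B)).prod *
        scalarMap _ (k.map fun a => (l.map fun b =>
          kernelDen t (dA a) (dB b) (.inl a) (.inr b)).prod).prod =
      (l.map fun b => vFactor R (dB b) (Sum.inr b : A ⊕ B)).prod *
        (k.map fun a => uFactor t (dA a) (Sum.inl a : A ⊕ B)).prod *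
        scalarMap _ (k.map fun a => (l.map fun b =>
          kernelNum t (dA a) (dB b) (.inl a) (.inr b)).prod).prod :=
  list_prod_mul_list_prod_twisted (M := MvPowerSeries (A ⊕ B) (PlacticCompletion R))
    (C := MvPowerSeries (A ⊕ B) R) (scalarMap _) (fun c F => scalarMap_commute c F) _ _
    (fun a b => kernelDen t (dA a) (dB b) (.inl a) (.inr b))
    (fun a b => kernelNum t (dA a) (dB b) (.inl a) (.inr b))
    (fun a b => uFactor_mul_vFactor t (dA a) (dB b) _ _) k l

/-- The form without division, `Q * P * D = P * Q * N`, is verified up to each exponent `d`, where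
all four limits may be replaced by finite products. The constant term of `D` is `1`, so `D` can be
inverted at the end. -/
theorem exists_cauchy_identity [LinearOrder A] [LinearOrder B] (t : R) (dA : A → ZMod 2)
    (dB : B → ZMod 2) :
    ∃ K : MvPowerSeries (A ⊕ B) R, IsCauchyKernel t dA dB K ∧
      ∃ Q P : MvPowerSeries (A ⊕ B) (PlacticCompletion R),
        (∀ d, ∀ᶠ s in atTop,
          AgreeUpTo d Q (sortedProd (fun a => uFactor t (dA a) (.inl a)) s)) ∧
        (∀ d, ∀ᶠ s in atTop, AgreeUpTo d P (sortedProd (fun b => vFactor R (dB b) (.inr b)) s)) ∧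
        Q * P = P * Q * MvPowerSeries.map (algebraMap R (PlacticCompletion R)) K := by
  classical
  obtain ⟨Q, hQ⟩ := (locallyFiniteFactors_of_exponent (Sum.inl_injective (α := A) (β := B))
    fun d a h => uFactor_agreeUpTo_one t (dA a) h).exists_sortedProd_limit
  obtain ⟨P, hP⟩ := (locallyFiniteFactors_of_exponent (Sum.inr_injective (α := A) (β := B))
    fun d b h => vFactor_agreeUpTo_one (R := R) (dB b) h).exists_sortedProd_limit
  have hone : ∀ (d : A ⊕ B →₀ ℕ) a b, ¬ (d (.inl a) ≠ 0 ∧ d (.inr b) ≠ 0) →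
      AgreeUpTo d (1 + scalarTerm t (.inl a) (.inr b)) 1 := fun d a b h => by
    simpa using (AgreeUpTo.refl d 1).add (scalarTerm_agreeUpTo_zero t h)
  have hone' : ∀ (d : A ⊕ B →₀ ℕ) a b, ¬ (d (.inl a) ≠ 0 ∧ d (.inr b) ≠ 0) →
      AgreeUpTo d (1 - scalarTerm t (.inl a) (.inr b)) 1 := fun d a b h => by
    simpa using (AgreeUpTo.refl d 1).sub (scalarTerm_agreeUpTo_zero t h)
  obtain ⟨N, hN⟩ := (locallyFiniteFactors_of_pair (p := fun c : A × B => dA c.1 ≠ dB c.2)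
    fun d c h => hone d c.1.1 c.1.2 h).exists_prod_limit
  obtain ⟨D, hD⟩ := (locallyFiniteFactors_of_pair (p := fun c : A × B => dA c.1 = dB c.2)
    fun d c h => hone' d c.1.1 c.1.2 h).exists_prod_limit
  have hD0 : MvPowerSeries.constantCoeff D = 1 := by
    obtain ⟨s, hs⟩ := (hD 0).exists
    refine constantCoeff_eq_one (hs.trans ?_)
    rw [← Finset.prod_map_toList]
    refine AgreeUpTo.list_prod_one _ fun F hF => ?_
    obtain ⟨c, -, rfl⟩ := List.mem_map.1 hF
    exact hone' 0 _ _ (by simp)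
  have hDinv : D * MvPowerSeries.invOfUnit D 1 = 1 := MvPowerSeries.mul_invOfUnit _ _ hD0
  have key : Q * P * scalarMap _ D = P * Q * scalarMap _ N := by
    refine eq_of_agreeUpTo fun d => ?_
    have hQ' : ∀ᶠ s : Finset A × Finset B in atTop, AgreeUpTo d Q
        (sortedProd (fun a => uFactor t (dA a) (.inl a)) s.1) := by
      rw [← prod_atTop_atTop_eq]
      exact tendsto_fst.eventually (hQ d)
    have hP' : ∀ᶠ s : Finset A × Finset B in atTop, AgreeUpTo d P
        (sortedProd (fun b => vFactor R (dB b) (.inr b)) s.2) := by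
      rw [← prod_atTop_atTop_eq]
      exact tendsto_snd.eventually (hP d)
    -- A single rectangle large enough for `Q`, `P`, `N` and `D` at once.
    obtain ⟨s, ⟨⟨h1, h2⟩, h3⟩, h4⟩ := (((hQ'.and hP').and
      ((tendsto_subtype_product _).eventually (hN d))).and
      ((tendsto_subtype_product _).eventually (hD d))).exists
    have hfin := list_prod_uFactor_mul_list_prod_vFactor t dA dB (s.1.sort (· ≤ ·))
      (s.2.sort (· ≤ ·))
    rw [prod_subtype_product _ fun a b => 1 + scalarTerm t (Sum.inl a : A ⊕ B) (Sum.inr b)] at h3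
    rw [prod_subtype_product _ fun a b => 1 - scalarTerm t (Sum.inl a : A ⊕ B) (Sum.inr b)] at h4
    refine ((h1.mul h2).mul (h4.map _)).trans (AgreeUpTo.trans ?_
      ((h2.mul h1).mul (h3.map _)).symm)
    intro e _
    exact congrArg _ hfin
  refine ⟨N * MvPowerSeries.invOfUnit D 1, ⟨N, D, ?_, ?_, ?_⟩, Q, P, hQ, hP, ?_⟩
  · let _ : TopologicalSpace R := ⊥
    have h := tendsto_of_eventually_agreeUpTo hN
    -- `HasProd` takes its limit along the unconditional summation filter, which is `atTop` on
    -- finite sets.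
    rwa [← SummationFilter.unconditional_filter] at h
  · let _ : TopologicalSpace R := ⊥
    have h := tendsto_of_eventually_agreeUpTo hD
    rwa [← SummationFilter.unconditional_filter] at h
  · rw [mul_assoc, mul_comm _ D, hDinv, mul_one]
  · change Q * P = P * Q * scalarMap _ _
    rw [map_mul, ← mul_assoc, ← key, mul_assoc (Q * P), ← map_mul, hDinv, map_one, mul_one]

variable {E : Type*} [Ring E] [TopologicalSpace E] {φ : PlacticCompletion R →+* E}

theorem BoundedContinuous.isCauchyQ [LinearOrder A] (hφ : BoundedContinuous φ) {σ : Type*}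
    {x : A → σ} {t : R} {d : A → ZMod 2} {Q : MvPowerSeries σ (PlacticCompletion R)}
    (hQ : ∀ e, ∀ᶠ s in atTop, AgreeUpTo e Q (sortedProd (fun a => uFactor t (d a) (x a)) s)) :
    IsCauchyQ (fun i => φ (letterSeq .pos t i)) x d (MvPowerSeries.map φ Q) :=
  ⟨_, fun a => hφ.isQFactor t (x a) (d a), isOrderedProd_of_eventually_agreeUpTo fun e => by
    filter_upwards [hQ e] with s hs
    rw [sortedProd_map]
    exact hs.map φ⟩

theorem BoundedContinuous.isCauchyP [LinearOrder B] (hφ : BoundedContinuous φ) {σ : Type*}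
    {x : B → σ} {d : B → ZMod 2} {P : MvPowerSeries σ (PlacticCompletion R)}
    (hP : ∀ e, ∀ᶠ s in atTop, AgreeUpTo e P (sortedProd (fun b => vFactor R (d b) (x b)) s)) :
    IsCauchyP (fun i => φ (letterSeq .dual 1 i)) x d (MvPowerSeries.map φ P) :=
  ⟨_, fun b => hφ.isPFactor (x b) (d b), isOrderedProd_of_eventually_agreeUpTo fun e => by
    filter_upwards [hP e] with s hs
    rw [sortedProd_map]
    exact hs.map φ⟩

end CauchyIdentity

end PlacticCauchy

namespace PlacticCauchy

open PlacticMonoid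

/-! ### Young diagrams as configurations of tokens -/

section YoungDiagrams

theorem eq_iff_rowLen_eq {μ ν : YoungDiagram} : μ = ν ↔ ∀ i, μ.rowLen i = ν.rowLen i := by
  refine ⟨fun h i => by rw [h], fun h => ?_⟩
  ext ⟨i, j⟩
  rw [YoungDiagram.mem_cells, YoungDiagram.mem_cells, YoungDiagram.mem_iff_lt_rowLen,
    YoungDiagram.mem_iff_lt_rowLen, h]

theorem eq_of_forall_lt_iff {a b : ℕ} (h : ∀ j, j < a ↔ j < b) : a = b :=
  le_antisymm (not_lt.1 fun hlt => lt_irrefl _ ((h b).1 hlt))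
    (not_lt.1 fun hlt => lt_irrefl _ ((h a).2 hlt))

theorem rowLen_of_addBox {i : ℕ} {μ ν : YoungDiagram} (h : addBox i μ = some ν) (k : ℕ) :
    ν.rowLen k = if k = i then μ.rowLen i + 1 else μ.rowLen k := by
  rw [addBox] at h
  split_ifs at h with hl
  obtain rfl := Option.some.inj h
  refine eq_of_forall_lt_iff fun j => ?_
  rw [← YoungDiagram.mem_iff_lt_rowLen, ← YoungDiagram.mem_cells]
  simp only [Finset.mem_insert, Prod.mk.injEq, YoungDiagram.mem_cells,
    YoungDiagram.mem_iff_lt_rowLen]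
  split_ifs with hk
  · subst hk
    omega
  · omega

theorem rowLen_of_removeBox {i : ℕ} {μ ν : YoungDiagram} (h : removeBox i μ = some ν) :
    0 < μ.rowLen i ∧ ∀ k, ν.rowLen k = if k = i then μ.rowLen i - 1 else μ.rowLen k := by
  rw [removeBox] at h
  split_ifs at h with hl
  obtain rfl := Option.some.inj h
  refine ⟨hl.1, fun k => eq_of_forall_lt_iff fun j => ?_⟩
  rw [← YoungDiagram.mem_iff_lt_rowLen, ← YoungDiagram.mem_cells]
  simp only [Finset.mem_erase, ne_eq, Prod.mk.injEq, YoungDiagram.mem_cells,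
    YoungDiagram.mem_iff_lt_rowLen]
  split_ifs with hk
  · subst hk
    omega
  · omega

theorem isLowerSet_coe_iff (s : Finset (ℕ × ℕ)) : IsLowerSet (s : Set (ℕ × ℕ)) ↔
    ∀ i j, (i, j) ∈ s → ∀ i' j', i' ≤ i → j' ≤ j → (i', j') ∈ s :=
  ⟨fun h _ _ hm _ _ hi hj => h (Prod.mk_le_mk.2 ⟨hi, hj⟩) hm,
    fun h _ _ hle hm => h _ _ hm _ _ hle.1 hle.2⟩

theorem addBox_eq_none {i : ℕ} {μ : YoungDiagram} (h : addBox i μ = none) :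
    ∃ k, i = k + 1 ∧ μ.rowLen k = μ.rowLen i := by
  rw [addBox] at h
  split_ifs at h with hl
  by_contra! hne
  refine hl ((isLowerSet_coe_iff _).2 fun a b hab a' b' ha hb => ?_)
  simp only [Finset.mem_insert, Prod.mk.injEq, YoungDiagram.mem_cells,
    YoungDiagram.mem_iff_lt_rowLen] at hab ⊢
  rcases hab with ⟨rfl, rfl⟩ | hab
  · rcases ha.eq_or_lt with rfl | ha
    · omega
    · obtain ⟨k, rfl⟩ : ∃ k, a = k + 1 := ⟨a - 1, by omega⟩
      have h1 := hne k rfl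
      have h2 := μ.rowLen_anti k (k + 1) (by omega)
      have h3 := μ.rowLen_anti a' k (by omega)
      omega
  · have := μ.rowLen_anti a' a ha
    omega

/-- This covers an empty row `i` as well, since then row `i + 1` is empty too. -/
theorem removeBox_eq_none {i : ℕ} {μ : YoungDiagram} (h : removeBox i μ = none) :
    μ.rowLen i = μ.rowLen (i + 1) := by
  rw [removeBox] at h
  split_ifs at h with hl
  by_contra hne
  have h1 := μ.rowLen_anti i (i + 1) (by omega)
  refine hl ⟨by omega, (isLowerSet_coe_iff _).2 fun a b hab a' b' ha hb => ?_⟩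
  simp only [Finset.mem_erase, ne_eq, Prod.mk.injEq, YoungDiagram.mem_cells,
    YoungDiagram.mem_iff_lt_rowLen] at hab ⊢
  have h2 := μ.rowLen_anti a' a ha
  refine ⟨?_, by omega⟩
  rintro ⟨rfl, rfl⟩
  rcases ha.eq_or_lt with rfl | ha
  · omega
  · have := μ.rowLen_anti (a' + 1) a ha
    omega

/-- The number of columns of length `p + 1`. -/
def columnCount (μ : YoungDiagram) (p : ℕ) : ℕ := μ.rowLen p - μ.rowLen (p + 1)

theorem exists_rowLen_eq_zero (μ : YoungDiagram) : ∃ L, ∀ i, L ≤ i → μ.rowLen i = 0 := by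
  refine ⟨μ.colLen 0, fun i hi => Nat.eq_zero_of_not_pos fun h => ?_⟩
  rw [← YoungDiagram.mem_iff_lt_rowLen, YoungDiagram.mem_iff_lt_colLen] at h
  omega

/-- Row lengths are recovered from their successive differences, upwards from the rows that are
zero. -/
theorem columnCount_injective : Function.Injective columnCount := by
  intro μ ν h
  obtain ⟨L, hL⟩ := exists_rowLen_eq_zero μ
  obtain ⟨L', hL'⟩ := exists_rowLen_eq_zero ν
  -- `n` bounds the distance from row `i` to the empty rows.
  have key : ∀ n i, max L L' ≤ i + n → μ.rowLen i = ν.rowLen i := by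
    intro n
    induction n with
    | zero => intro i hi; rw [hL i (by omega), hL' i (by omega)]
    | succ n ih =>
      intro i hi
      have h1 := ih (i + 1) (by omega)
      have h2 : μ.rowLen i - μ.rowLen (i + 1) = ν.rowLen i - ν.rowLen (i + 1) := congrFun h i
      have h3 := μ.rowLen_anti i (i + 1) (by omega)
      have h4 := ν.rowLen_anti i (i + 1) (by omega)
      omega
  exact eq_iff_rowLen_eq.2 fun i => key (max L L') i (by omega)

/-- The partial map on Young diagrams that a letter induces. -/
noncomputable def letterStep : Letter → YoungDiagram → Option YoungDiagram
  | .pos i => removeBox i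
  | .dual i => addBox i

/-- Removing the last box of row `i` shortens a column of length `i + 1`: place `i` loses a token
and place `i - 1`, if there is one, gains it. Adding a box does the reverse. -/
theorem tokenStep_columnCount_of_some {x : Letter} {μ ν : YoungDiagram}
    (h : letterStep x μ = some ν) (p : ℕ) :
    tokenStep p x (some (columnCount μ p)) = some (columnCount ν p) := by
  have down_succ : ∀ n m : ℕ, n = m + 1 → down (some n) = some m := by rintro _ m rfl; rfl
  have up_succ : ∀ n m : ℕ, m = n + 1 → up (some n) = some m := by rintro n _ rfl; rfl
  have hμ := μ.rowLen_anti p (p + 1) (by omega)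
  have hν := ν.rowLen_anti p (p + 1) (by omega)
  cases x with
  | pos i =>
    obtain ⟨h0, hr⟩ := rowLen_of_removeBox h
    rw [tokenStep]
    simp only [columnCount]
    rw [hr, hr] at hν ⊢
    split_ifs at hν ⊢ with h1 h2 h3 h4
    all_goals first
      | omega
      | exact down_succ _ _ (by subst_vars; omega)
      | exact up_succ _ _ (by subst_vars; omega)
      | rfl
  | dual i =>
    have hr := rowLen_of_addBox h
    rw [tokenStep]
    simp only [columnCount]
    rw [hr, hr] at hν ⊢
    split_ifs at hν ⊢ with h1 h2 h3 h4
    all_goals first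
      | omega
      | exact down_succ _ _ (by subst_vars; omega)
      | exact up_succ _ _ (by subst_vars; omega)
      | rfl

/-- A blocked letter asks an empty place for a token: place `i` when removing from row `i`, place `i
- 1` when adding to row `i`. -/
theorem exists_tokenStep_columnCount_of_none {x : Letter} {μ : YoungDiagram}
    (h : letterStep x μ = none) : ∃ p, tokenStep p x (some (columnCount μ p)) = none := by
  cases x with
  | pos i =>
    have := removeBox_eq_none h
    refine ⟨i, ?_⟩
    rw [tokenStep, if_pos rfl, columnCount, this, Nat.sub_self]
    rfl
  | dual i =>
    obtain ⟨k, rfl, hk⟩ := addBox_eq_none h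
    refine ⟨k, ?_⟩
    rw [tokenStep, if_neg (by omega), if_pos rfl, columnCount, hk, Nat.sub_self]
    rfl

theorem tokenStep_none (p : ℕ) (x : Letter) : tokenStep p x none = none := by
  cases x <;> simp only [tokenStep] <;> split_ifs <;> rfl

/-- The partial map on Young diagrams that a word induces. -/
noncomputable def wordStep (w : List Letter) (μ : YoungDiagram) : Option YoungDiagram :=
  w.foldr (fun x o => o.bind (letterStep x)) (some μ)

theorem token_of_mul (p : ℕ) (x : Letter) (w : FreeMonoid Letter) (o : Option ℕ) :
    token p (PlacticMonoid.mk (.of x * w)) o = tokenStep p x (token p (PlacticMonoid.mk w) o) := by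
  rw [map_mul, map_mul]
  rfl

theorem token_columnCount_of_some (w : FreeMonoid Letter) {μ ν : YoungDiagram}
    (h : wordStep w.toList μ = some ν) (p : ℕ) :
    token p (PlacticMonoid.mk w) (some (columnCount μ p)) = some (columnCount ν p) := by
  induction w using FreeMonoid.inductionOn' generalizing ν with
  | one =>
    obtain rfl : μ = ν := Option.some.inj h
    rw [map_one, map_one]
    rfl
  | of_mul x w ih =>
    rw [token_of_mul]
    have h' : (wordStep w.toList μ).bind (letterStep x) = some ν := h
    obtain ⟨ρ, hρ, hx⟩ := Option.bind_eq_some_iff.1 h'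
    rw [ih hρ, tokenStep_columnCount_of_some hx]

theorem exists_token_columnCount_of_none (w : FreeMonoid Letter) {μ : YoungDiagram}
    (h : wordStep w.toList μ = none) :
    ∃ p, token p (PlacticMonoid.mk w) (some (columnCount μ p)) = none := by
  induction w using FreeMonoid.inductionOn' with
  | one => exact absurd h (by simp [wordStep])
  | of_mul x w ih =>
    have h' : (wordStep w.toList μ).bind (letterStep x) = none := h
    rcases hw : wordStep w.toList μ with _ | ρ
    · obtain ⟨p, hp⟩ := ih hw
      exact ⟨p, by rw [token_of_mul, hp, tokenStep_none]⟩
    · rw [hw, Option.bind_some] at h'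
      obtain ⟨p, hp⟩ := exists_tokenStep_columnCount_of_none h'
      exact ⟨p, by rw [token_of_mul, token_columnCount_of_some w hw, hp]⟩

/-- The token actions depend only on the class of the word. They detect whether the word is defined
on `μ`, and if so they give the column counts of the result, which determine it. -/
theorem wordStep_eq_of_mk_eq {w w' : FreeMonoid Letter}
    (h : PlacticMonoid.mk w = PlacticMonoid.mk w') (μ : YoungDiagram) :
    wordStep w.toList μ = wordStep w'.toList μ := by
  have aux : ∀ {w w' : FreeMonoid Letter} {ν}, PlacticMonoid.mk w = PlacticMonoid.mk w' →
      wordStep w.toList μ = some ν → wordStep w'.toList μ = some ν := by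
    intro w w' ν h hν
    rcases hw' : wordStep w'.toList μ with _ | ν'
    · obtain ⟨p, hp⟩ := exists_token_columnCount_of_none w' hw'
      rw [← h, token_columnCount_of_some w hν] at hp
      cases hp
    · congr 1
      refine columnCount_injective (funext fun p => ?_)
      have := token_columnCount_of_some w' hw' p
      rw [← h, token_columnCount_of_some w hν] at this
      exact (Option.some.inj this).symm
  rcases hw : wordStep w.toList μ with _ | ν
  · rcases hw' : wordStep w'.toList μ with _ | ν'
    · rfl
    · rw [aux h.symm hw'] at hw
      cases hw
  · exact (aux h hw).symm

end YoungDiagrams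

/-! ### The representation by Schur operators -/

section SchurRepresentation

variable {R : Type*} [CommRing R]

/-- The Schur operator of a letter, at `t = 1`. -/
noncomputable def schurLetter (R : Type*) [CommRing R] : Letter → Module.End R (SchurModule R)
  | .pos i => schurDown 1 i
  | .dual i => schurUp R i

theorem schurLetter_single (x : Letter) (μ : YoungDiagram) :
    schurLetter R x (Finsupp.single μ 1) =
      (letterStep x μ).elim 0 fun ν => Finsupp.single ν 1 := by
  cases x <;> simp [schurLetter, schurDown, schurUp, letterStep]

theorem lift_schurLetter_single (w : FreeMonoid Letter) (μ : YoungDiagram) :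
    FreeMonoid.lift (schurLetter R) w (Finsupp.single μ 1) =
      (wordStep w.toList μ).elim 0 fun ν => Finsupp.single ν 1 := by
  induction w using FreeMonoid.inductionOn' with
  | one => rw [map_one]; rfl
  | of_mul x w ih =>
    have h' : wordStep (FreeMonoid.of x * w).toList μ =
      (wordStep w.toList μ).bind (letterStep x) := rfl
    rw [map_mul, Module.End.mul_apply, ih, h', FreeMonoid.lift_eval_of]
    rcases wordStep w.toList μ with _ | ρ
    · exact map_zero _
    · exact schurLetter_single x ρ

/-- The action of the plactic monoid on symmetric functions through the Schur operators. -/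
noncomputable def schurRep (R : Type*) [CommRing R] :
    PlacticMonoid →* Module.End R (SchurModule R) :=
  PresentedMonoid.lift (schurLetter R) fun a b hab => by
    refine Finsupp.lhom_ext' fun μ => LinearMap.ext_ring ?_
    change FreeMonoid.lift (schurLetter R) a (Finsupp.single μ 1) =
      FreeMonoid.lift (schurLetter R) b (Finsupp.single μ 1)
    rw [lift_schurLetter_single, lift_schurLetter_single,
      wordStep_eq_of_mk_eq (PresentedMonoid.mk_eq_mk_of_rel hab)]

theorem schurRep_of (x : Letter) : schurRep R (PlacticMonoid.mk (.of x)) = schurLetter R x := rfl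

theorem schurRep_mk_single (w : FreeMonoid Letter) (μ : YoungDiagram) :
    schurRep R (PlacticMonoid.mk w) (Finsupp.single μ 1) =
      (wordStep w.toList μ).elim 0 fun ν => Finsupp.single ν 1 :=
  lift_schurLetter_single w μ

/-- The places from the number of rows of `μ` on hold no token. A word that does not kill `s_μ` is
defined at these places, which by `index_le_of_token` bounds the indices of its letters; finitely
many words remain. -/
theorem finite_schurRep_single_ne_zero (n : ℕ) (μ : YoungDiagram) :
    {m | m ∈ lengthLE n ∧ schurRep R m (Finsupp.single μ 1) ≠ 0}.Finite := by
  obtain ⟨L, hL⟩ := exists_rowLen_eq_zero μ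
  refine ((words_finite n (L + n)).image PlacticMonoid.mk).subset ?_
  rintro _ ⟨⟨w, hw, rfl⟩, hne⟩
  refine ⟨w, ⟨hw, fun x hx => ?_⟩, rfl⟩
  have h := index_le_of_token L w (fun p hp hnone => ?_) x hx
  · omega
  · rw [schurRep_mk_single] at hne
    rcases hν : wordStep w.toList μ with _ | ν
    · rw [hν] at hne
      exact hne rfl
    · have h0 : columnCount μ p = 0 := by rw [columnCount, hL p hp, Nat.zero_sub]
      have := token_columnCount_of_some w hν p
      rw [h0, hnone] at this
      cases this

theorem finite_schurRep_ne_zero (n : ℕ) (x : SchurModule R) :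
    {m | m ∈ lengthLE n ∧ schurRep R m x ≠ 0}.Finite := by
  induction x using Finsupp.induction_linear with
  | zero => simp
  | add x y hx hy =>
    refine (hx.union hy).subset ?_
    rintro m ⟨hm, hne⟩
    by_cases h : schurRep R m x = 0
    · exact .inr ⟨hm, fun h' => hne (by rw [map_add, h, h', add_zero])⟩
    · exact .inl ⟨hm, h⟩
  | single μ c =>
    refine (finite_schurRep_single_ne_zero (R := R) n μ).subset ?_
    rintro m ⟨hm, hne⟩
    refine ⟨hm, fun h => hne ?_⟩
    rw [← mul_one c, ← smul_eq_mul, ← Finsupp.smul_single, map_smul, h, smul_zero]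

end SchurRepresentation

end PlacticCauchy

namespace PlacticCauchy

open Filter Topology PlacticMonoid PlacticCompletion

/-! ### Extension of the representation to the completion -/

section SchurCompletion

variable {R : Type*} [CommRing R]

theorem finite_support_smul_schurRep (f : PlacticCompletion R) (x : SchurModule R) :
    (Function.support fun m => f m • schurRep R m x).Finite := by
  obtain ⟨n, hn⟩ := f.bounded
  refine (finite_schurRep_ne_zero n x).subset fun m hm => ?_
  rw [Function.mem_support] at hm
  exact ⟨hn m fun h => hm (by rw [h, zero_smul]), fun h => hm (by rw [h, smul_zero])⟩

/-- The operator `∑ f m • [m]` on symmetric functions. -/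
noncomputable def schurEnd (f : PlacticCompletion R) : Module.End R (SchurModule R) where
  toFun x := ∑ᶠ m, f m • schurRep R m x
  map_add' x y := by
    simp only [map_add, smul_add]
    exact finsum_add_distrib (finite_support_smul_schurRep f x) (finite_support_smul_schurRep f y)
  map_smul' c x := by
    rw [RingHom.id_apply, smul_finsum' c (finite_support_smul_schurRep f x)]
    exact finsum_congr fun m => by rw [map_smul, smul_comm]

theorem schurEnd_apply (f : PlacticCompletion R) (x : SchurModule R) :
    schurEnd f x = ∑ᶠ m, f m • schurRep R m x := rfl

theorem schurEnd_apply_eq_sum {n : ℕ} {f : PlacticCompletion R} (hf : f ∈ boundedLE R n)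
    (x : SchurModule R) {T : Finset PlacticMonoid}
    (hT : {m | m ∈ lengthLE n ∧ schurRep R m x ≠ 0} ⊆ T) :
    schurEnd f x = ∑ m ∈ T, f m • schurRep R m x := by
  refine finsum_eq_sum_of_support_subset _ fun m hm => hT ?_
  rw [Function.mem_support] at hm
  exact ⟨hf m fun h => hm (by rw [h, zero_smul]), fun h => hm (by rw [h, smul_zero])⟩

theorem schurEnd_single (a : PlacticMonoid) : schurEnd (single a) = schurRep R a := by
  classical
  refine LinearMap.ext fun x => ?_
  rw [schurEnd_apply, finsum_eq_single _ a fun m hm => ?_]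
  · rw [single_apply, if_pos rfl, one_smul]
  · rw [single_apply, if_neg hm, zero_smul]

theorem schurEnd_add (f g : PlacticCompletion R) : schurEnd (f + g) = schurEnd f + schurEnd g := by
  refine LinearMap.ext fun x => ?_
  rw [LinearMap.add_apply, schurEnd_apply, schurEnd_apply, schurEnd_apply,
    ← finsum_add_distrib (finite_support_smul_schurRep f x) (finite_support_smul_schurRep g x)]
  exact finsum_congr fun m => by rw [PlacticCompletion.add_apply, add_smul]

theorem schurEnd_smul (c : R) (f : PlacticCompletion R) : schurEnd (c • f) = c • schurEnd f := by
  refine LinearMap.ext fun x => ?_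
  rw [LinearMap.smul_apply, schurEnd_apply, schurEnd_apply,
    smul_finsum' c (finite_support_smul_schurRep f x)]
  exact finsum_congr fun m => by rw [PlacticCompletion.smul_apply, mul_smul]

/-- On a fixed vector both sides are the finite sum of `(f a * g b) • [a b] x` over `T₁ ×ˢ T₂`,
where `T₂` collects the short `b` not killing `x`, and `T₁` the short `a` not killing some `[b] x`
with `b ∈ T₂`. -/
theorem schurEnd_mul (f g : PlacticCompletion R) : schurEnd (f * g) = schurEnd f * schurEnd g := by
  classical
  obtain ⟨n, hf⟩ := f.bounded
  obtain ⟨k, hg⟩ := g.bounded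
  refine LinearMap.ext fun x => ?_
  set T₂ := (finite_schurRep_ne_zero k x).toFinset with hT₂
  set T₁ := T₂.biUnion fun b => (finite_schurRep_ne_zero n (schurRep R b x)).toFinset with hT₁
  -- The products of pairs are included so that each pair meets its own `m` when the sum is
  -- regrouped.
  set M := (finite_schurRep_ne_zero (n + k) x).toFinset ∪
    (T₁ ×ˢ T₂).image fun p => p.1 * p.2 with hM
  have hmem₂ : ∀ b, b ∈ lengthLE k → schurRep R b x ≠ 0 → b ∈ T₂ := fun b h h' => by
    simp [hT₂, h, h']
  have hmem₁ : ∀ a b, a ∈ lengthLE n → b ∈ T₂ → schurRep R a (schurRep R b x) ≠ 0 → a ∈ T₁ :=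
    fun a b h h' h'' => by
      rw [hT₁, Finset.mem_biUnion]
      exact ⟨b, h', by simp [h, h'']⟩
  have hfg : ∀ m, (f * g) m • schurRep R m x =
      ∑ p ∈ T₁ ×ˢ T₂, if p.1 * p.2 = m then (f p.1 * g p.2) • schurRep R (p.1 * p.2) x else 0 := by
    intro m
    -- If `[m] x = 0`, both sides vanish. Otherwise every pair contributing to the coefficient of
    -- `m` acts nontrivially on `x` and lies in `T₁ ×ˢ T₂`.
    by_cases hm : schurRep R m x = 0
    · rw [hm, smul_zero, Finset.sum_eq_zero]
      intro p _
      split_ifs with h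
      · rw [h, hm, smul_zero]
      · rfl
    rw [PlacticCompletion.mul_apply, mulFun,
      finsum_eq_sum_of_support_subset (s := T₁ ×ˢ T₂) _ ?_, Finset.sum_smul]
    · refine Finset.sum_congr rfl fun p _ => ?_
      split_ifs with h
      · rw [h]
      · rw [zero_smul]
    · intro p hp
      rw [Function.mem_support] at hp
      have hpm : p.1 * p.2 = m := by
        by_contra h
        exact hp (if_neg h)
      rw [if_pos hpm] at hp
      rw [← hpm, map_mul, Module.End.mul_apply] at hm
      have h2 := hmem₂ p.2 (hg _ (right_ne_zero_of_mul hp)) fun h => hm (by rw [h, map_zero])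
      rw [Finset.coe_product]
      exact ⟨hmem₁ p.1 p.2 (hf _ (left_ne_zero_of_mul hp)) h2 hm, h2⟩
  have hleft : schurEnd (f * g) x = ∑ p ∈ T₁ ×ˢ T₂, (f p.1 * g p.2) • schurRep R (p.1 * p.2) x := by
    rw [schurEnd_apply_eq_sum (mul_mem_boundedLE hf hg) x (T := M) fun m hm => by
      rw [hM, Finset.coe_union]; exact .inl (by simpa using hm)]
    rw [Finset.sum_congr rfl fun m _ => hfg m, Finset.sum_comm]
    refine Finset.sum_congr rfl fun p hp => ?_
    rw [Finset.sum_ite_eq, if_pos]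
    rw [hM, Finset.mem_union]
    exact .inr (Finset.mem_image_of_mem (fun p : PlacticMonoid × PlacticMonoid => p.1 * p.2) hp)
  rw [hleft, Module.End.mul_apply, schurEnd_apply_eq_sum hg x (T := T₂) fun m hm =>
    hmem₂ m hm.1 hm.2, map_sum, Finset.sum_product_right]
  refine Finset.sum_congr rfl fun b hb => ?_
  rw [map_smul, schurEnd_apply_eq_sum hf (schurRep R b x) (T := T₁) fun m hm =>
    hmem₁ m b hm.1 hb hm.2, Finset.smul_sum]
  refine Finset.sum_congr rfl fun a _ => ?_
  rw [map_mul, Module.End.mul_apply, mul_comm, mul_smul]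

/-- The action of the completed plactic algebra on symmetric functions. -/
noncomputable def schurAlgHom (R : Type*) [CommRing R] :
    PlacticCompletion R →ₐ[R] Module.End R (SchurModule R) :=
  AlgHom.ofLinearMap
    { toFun := schurEnd, map_add' := schurEnd_add, map_smul' := schurEnd_smul }
    (by
      change schurEnd 1 = 1
      rw [one_def, schurEnd_single, map_one])
    schurEnd_mul

theorem schurAlgHom_single (a : PlacticMonoid) : schurAlgHom R (single a) = schurRep R a :=
  schurEnd_single a

/-- By the uniform length bound, the value at `x` of every `f k` and of `g` is a sum over one and
the same finite set of monomials, on which the coefficients eventually coincide. -/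
theorem boundedContinuous_schurAlgHom :
    BoundedContinuous (E := Module.End R (SchurModule R)) (schurAlgHom R).toRingHom := by
  intro n f g hf hg h
  let _ : TopologicalSpace (SchurModule R) := ⊥
  have hind : Topology.IsInducing
      (fun f : Module.End R (SchurModule R) => (f : SchurModule R → SchurModule R)) := ⟨rfl⟩
  rw [hind.tendsto_nhds_iff, tendsto_pi_nhds]
  intro x
  refine tendsto_const_nhds.congr' ?_
  set T := (finite_schurRep_ne_zero n x).toFinset with hT
  have hsub : {m | m ∈ lengthLE n ∧ schurRep R m x ≠ 0} ⊆ T := fun m hm => by simpa [hT] using hm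
  filter_upwards [(eventually_all_finset T).2 fun m _ => h m] with k hk
  change schurEnd g x = schurEnd (f k) x
  rw [schurEnd_apply_eq_sum hg x hsub, schurEnd_apply_eq_sum (hf k) x hsub]
  exact Finset.sum_congr rfl fun m hm => by rw [hk m hm]

theorem schurAlgHom_letterSeq_pos (t : R) (i : ℕ) :
    schurAlgHom R (letterSeq .pos t i) = schurDown t i := by
  rw [letterSeq, map_smul, schurAlgHom_single, schurRep_of]
  refine Finsupp.lhom_ext' fun μ => LinearMap.ext_ring ?_
  simp only [schurLetter, schurDown, LinearMap.comp_apply, LinearMap.smul_apply,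
    Finsupp.lsingle_apply, Finsupp.linearCombination_single, one_smul]
  rcases removeBox i μ with _ | ν
  · exact smul_zero t
  · change t • Finsupp.single ν 1 = Finsupp.single ν t
    rw [Finsupp.smul_single, smul_eq_mul, mul_one]

theorem schurAlgHom_letterSeq_dual (i : ℕ) :
    schurAlgHom R (letterSeq .dual 1 i) = schurUp R i := by
  rw [letterSeq, one_smul, schurAlgHom_single, schurRep_of]
  rfl

end SchurCompletion

/-! ### Generators of the plactic algebra -/

section PlacticAlgebraGenerators

theorem adjoin_generators :
    Algebra.adjoin ℚ[T;T⁻¹] (Set.range PlacticAlgebra.u ∪ Set.range PlacticAlgebra.v) = ⊤ := by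
  rw [eq_top_iff]
  rintro x -
  obtain ⟨x, rfl⟩ := RingQuot.mkAlgHom_surjective ℚ[T;T⁻¹] _ x
  induction x using FreeAlgebra.induction with
  | grade0 r => rw [AlgHom.commutes]; exact Subalgebra.algebraMap_mem _ r
  | grade1 x =>
    cases x with
    | pos i => exact Algebra.subset_adjoin (.inl ⟨i, rfl⟩)
    | dual i => exact Algebra.subset_adjoin (.inr ⟨i, rfl⟩)
  | mul x y hx hy => rw [map_mul]; exact mul_mem hx hy
  | add x y hx hy => rw [map_add]; exact add_mem hx hy

theorem toCompletion_u_eq_letterSeq (i : ℕ) :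
    PlacticAlgebra.toCompletion (PlacticAlgebra.u i) =
      letterSeq .pos (LaurentPolynomial.T 1 : ℚ[T;T⁻¹]) i :=
  PlacticAlgebra.toCompletion_u i

theorem toCompletion_v_eq_letterSeq (i : ℕ) :
    PlacticAlgebra.toCompletion (PlacticAlgebra.v i) = letterSeq .dual (1 : ℚ[T;T⁻¹]) i := by
  rw [PlacticAlgebra.toCompletion_v, letterSeq, one_smul]
  rfl

end PlacticAlgebraGenerators

end PlacticCauchy

namespace PlacticCauchy

open Filter

/-! ### Cauchy products of Schur operators -/

section SchurCauchyProducts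

variable {R : Type*} [CommRing R] {σ : Type*} {A : Type*} [LinearOrder A] {x : A → σ}
  {d : A → ZMod 2}

theorem isCauchyQ_schurDown {t : R} {Q : MvPowerSeries σ (PlacticCompletion R)}
    (hQ : ∀ e, ∀ᶠ s in atTop, AgreeUpTo e Q (sortedProd (fun a => uFactor t (d a) (x a)) s)) :
    IsCauchyQ (schurDown t) x d (MvPowerSeries.map (schurAlgHom R).toRingHom Q) := by
  have h := boundedContinuous_schurAlgHom.isCauchyQ hQ
  rwa [show (fun i => (schurAlgHom R).toRingHom (letterSeq .pos t i)) = schurDown t from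
    funext (schurAlgHom_letterSeq_pos t)] at h

theorem isCauchyP_schurUp {P : MvPowerSeries σ (PlacticCompletion R)}
    (hP : ∀ e, ∀ᶠ s in atTop, AgreeUpTo e P (sortedProd (fun b => vFactor R (d b) (x b)) s)) :
    IsCauchyP (schurUp R) x d (MvPowerSeries.map (schurAlgHom R).toRingHom P) := by
  have h := boundedContinuous_schurAlgHom.isCauchyP hP
  rwa [show (fun i => (schurAlgHom R).toRingHom (letterSeq .dual 1 i)) = schurUp R from
    funext schurAlgHom_letterSeq_dual] at h

theorem map_schurAlgHom_identity {Q P : MvPowerSeries σ (PlacticCompletion R)}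
    {K : MvPowerSeries σ R}
    (h : Q * P = P * Q * MvPowerSeries.map (algebraMap R (PlacticCompletion R)) K) :
    MvPowerSeries.map (schurAlgHom R).toRingHom Q * MvPowerSeries.map (schurAlgHom R).toRingHom P =
      MvPowerSeries.map (schurAlgHom R).toRingHom P *
        MvPowerSeries.map (schurAlgHom R).toRingHom Q *
        MvPowerSeries.map (algebraMap R (Module.End R (SchurModule R))) K := by
  have hK : MvPowerSeries.map (schurAlgHom R).toRingHom
      (MvPowerSeries.map (algebraMap R (PlacticCompletion R)) K) =
      MvPowerSeries.map (algebraMap R (Module.End R (SchurModule R))) K := by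
    ext1 e
    rw [MvPowerSeries.coeff_map, MvPowerSeries.coeff_map, MvPowerSeries.coeff_map]
    exact (schurAlgHom R).commutes _
  rw [← hK, ← map_mul, h, map_mul, map_mul]

end SchurCauchyProducts

end PlacticCauchy

/-- The Cauchy identity for plactic Cauchy products, its image for Schur operators, and the latter at
`t = 1`. The variables are `x_a = Sum.inl a` and `x_b = Sum.inr b`; `dA`, `dB` are the degrees. -/
theorem mainTheorem2 {A B : Type*} [LinearOrder A] [LinearOrder B] [Countable A] [Countable B]
    (dA : A → ZMod 2) (dB : B → ZMod 2) :
    (∃ K : MvPowerSeries (A ⊕ B) ℚ[T;T⁻¹],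
      IsCauchyKernel (LaurentPolynomial.T 1) dA dB K ∧
      -- the identity in the completed plactic algebra
      ∃ Q P : MvPowerSeries (A ⊕ B) (PlacticCompletion ℚ[T;T⁻¹]),
        IsCauchyQ (fun i => PlacticAlgebra.toCompletion (PlacticAlgebra.u i)) Sum.inl dA Q ∧
        IsCauchyP (fun i => PlacticAlgebra.toCompletion (PlacticAlgebra.v i)) Sum.inr dB P ∧
        Q * P = P * Q * MvPowerSeries.map (algebraMap ℚ[T;T⁻¹] (PlacticCompletion ℚ[T;T⁻¹])) K ∧
        -- the homomorphism to Schur operators, its extension to the completion, and the image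
        ∃ (ψ : PlacticAlgebra →ₐ[ℚ[T;T⁻¹]] Module.End ℚ[T;T⁻¹] (SchurModule ℚ[T;T⁻¹]))
          (ψhat : PlacticCompletion ℚ[T;T⁻¹] →ₐ[ℚ[T;T⁻¹]]
            Module.End ℚ[T;T⁻¹] (SchurModule ℚ[T;T⁻¹])),
          (∀ i, ψ (PlacticAlgebra.u i) = schurDown (LaurentPolynomial.T 1) i) ∧
          (∀ i, ψ (PlacticAlgebra.v i) = schurUp ℚ[T;T⁻¹] i) ∧
          ψ.range = Algebra.adjoin ℚ[T;T⁻¹]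
            (Set.range (schurDown (LaurentPolynomial.T 1 : ℚ[T;T⁻¹])) ∪
              Set.range (schurUp ℚ[T;T⁻¹])) ∧
          (∀ z, ψhat (PlacticAlgebra.toCompletion z) = ψ z) ∧
          ∃ Qbar Pbar : MvPowerSeries (A ⊕ B) (Module.End ℚ[T;T⁻¹] (SchurModule ℚ[T;T⁻¹])),
            IsCauchyQ (schurDown (LaurentPolynomial.T 1 : ℚ[T;T⁻¹])) Sum.inl dA Qbar ∧
            IsCauchyP (schurUp ℚ[T;T⁻¹]) Sum.inr dB Pbar ∧
            Qbar = MvPowerSeries.map (ψhat : PlacticCompletion ℚ[T;T⁻¹] →+* _) Q ∧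
            Pbar = MvPowerSeries.map (ψhat : PlacticCompletion ℚ[T;T⁻¹] →+* _) P ∧
            Qbar * Pbar = Pbar * Qbar * MvPowerSeries.map
              (algebraMap ℚ[T;T⁻¹] (Module.End ℚ[T;T⁻¹] (SchurModule ℚ[T;T⁻¹]))) K) ∧
    -- the identity for Schur operators at `t = 1`
    (∃ K : MvPowerSeries (A ⊕ B) ℚ, IsCauchyKernel 1 dA dB K ∧
      ∃ Q P : MvPowerSeries (A ⊕ B) (Module.End ℚ (SchurModule ℚ)),
        IsCauchyQ (schurDown (1 : ℚ)) Sum.inl dA Q ∧ IsCauchyP (schurUp ℚ) Sum.inr dB P ∧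
        Q * P = P * Q * MvPowerSeries.map (algebraMap ℚ (Module.End ℚ (SchurModule ℚ))) K) := by
  obtain ⟨K, hK, Q, P, hQ, hP, hQP⟩ :=
    exists_cauchy_identity (LaurentPolynomial.T 1 : ℚ[T;T⁻¹]) dA dB
  obtain ⟨K₁, hK₁, Q₁, P₁, hQ₁, hP₁, hQP₁⟩ := exists_cauchy_identity (1 : ℚ) dA dB
  -- The completed algebra itself is the target for the identity homomorphism, so the transport
  -- results apply to it as well.
  have hu : (fun i => PlacticAlgebra.toCompletion (PlacticAlgebra.u i)) = fun i =>
      RingHom.id (PlacticCompletion ℚ[T;T⁻¹]) (letterSeq .pos (LaurentPolynomial.T 1) i) :=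
    funext toCompletion_u_eq_letterSeq
  have hv : (fun i => PlacticAlgebra.toCompletion (PlacticAlgebra.v i)) = fun i =>
      RingHom.id (PlacticCompletion ℚ[T;T⁻¹]) (letterSeq .dual 1 i) :=
    funext toCompletion_v_eq_letterSeq
  have hψu : ∀ i, (schurAlgHom ℚ[T;T⁻¹]).comp PlacticAlgebra.toCompletion (PlacticAlgebra.u i) =
      schurDown (LaurentPolynomial.T 1) i := fun i => by
    rw [AlgHom.comp_apply, toCompletion_u_eq_letterSeq, schurAlgHom_letterSeq_pos]
  have hψv : ∀ i, (schurAlgHom ℚ[T;T⁻¹]).comp PlacticAlgebra.toCompletion (PlacticAlgebra.v i) =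
      schurUp ℚ[T;T⁻¹] i := fun i => by
    rw [AlgHom.comp_apply, toCompletion_v_eq_letterSeq, schurAlgHom_letterSeq_dual]
  refine ⟨⟨K, hK, Q, P, ?_, ?_, hQP, (schurAlgHom _).comp PlacticAlgebra.toCompletion,
    schurAlgHom _, hψu, hψv, ?_, fun _ => rfl, _, _, ?_, ?_, rfl, rfl, ?_⟩,
    K₁, hK₁, _, _, isCauchyQ_schurDown hQ₁, isCauchyP_schurUp hP₁, map_schurAlgHom_identity hQP₁⟩
  · rw [hu]
    simpa only [MvPowerSeries.map_id, RingHom.id_apply] using BoundedContinuous.id.isCauchyQ hQ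
  · rw [hv]
    simpa only [MvPowerSeries.map_id, RingHom.id_apply] using BoundedContinuous.id.isCauchyP hP
  -- The range is the image of the algebra generated by all `u i`, `v i`, hence is generated by
  -- their images.
  · rw [← Algebra.map_top, ← adjoin_generators, AlgHom.map_adjoin, Set.image_union,
      ← Set.range_comp, ← Set.range_comp]
    exact congrArg₂ (fun s s' => Algebra.adjoin _ (s ∪ s')) (congrArg Set.range (funext hψu))
      (congrArg Set.range (funext hψv))
  · exact isCauchyQ_schurDown hQ
  · exact isCauchyP_schurUp hP
  · exact map_schurAlgHom_identity hQP
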